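/- An operator algebra is a closed, not necessarily unital, subalgebra of a $C^*$-algebra, with the inherited matrix norms (considered up to completely isometric isomorphism). A $C^*$-cover of an operator algebra $B$ is a pair $(\mathcal{E}, j)$ consisting of a $C^*$-algebra $\mathcal{E}$ and a completely isometric homomorphism $j : B \to \mathcal{E}$ such that $j(B)$ generates $\mathcal{E}$ as a $C^*$-algebra. A $C^*$-cover $(\mathcal{E}, j)$ is maximal, written $\mathcal{E} = C^*_{\rm max}(B)$, if for every completely contractive homomorphism $\pi$ of $B$ into a $C^*$-algebra $\mathcal{F}$ there is a $*$-homomorphism $\varphi : \mathcal{E} \to \mathcal{F}$ with $\varphi \circ j = \pi$. Lemma. Let $B$ be an operator algebra and let $A$ be a closed two-sided ideal of $B$ which is approximately unital, that is, $A$ has a two-sided approximate identity of elements of norm at most $1$. Let $(C^*_{\rm max}(B), j)$ be a maximal $C^*$-cover of $B$, and let $\mathcal{D}$ be the $C^*$-subalgebra of $C^*_{\rm max}(B)$ generated by $j(A)$. Then: 1. $(\mathcal{D}, j|_A)$ is a maximal $C^*$-cover of $A$; that is, $C^*_{\rm max}(A) = \mathcal{D}$. 2. $\mathcal{D}$ is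 a closed two-sided ideal of $C^*_{\rm max}(B)$, and the quotient $C^*$-algebra $C^*_{\rm max}(B)/\mathcal{D}$, together with the homomorphism $B/A \to C^*_{\rm max}(B)/\mathcal{D}$ induced by $j$, is a maximal $C^*$-cover of $B/A$, where $M_n(B/A)$ carries the quotient norm of $M_n(B)/M_n(A)$ for each $n$; that is, $C^*_{\rm max}(B/A) = C^*_{\rm max}(B)/\mathcal{D}$. -/

import Mathlib

open Filter Topology

universe u v

/-! ### Matrix norms and operator algebras -/

/-- A family of functions `mnorm` on the square matrices over `B` of all sizes. It carries the
matrix norms of an operator algebra, of a subalgebra of one, or of a quotient of one. -/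
class MatrixNorm (B : Type u) where
  mnorm : {n : ℕ} → Matrix (Fin n) (Fin n) B → ℝ

/-- The norm of a matrix over a C⋆-algebra `C`, in the C⋆-algebra `M_n(C)`. (Mathlib's C⋆-norm on
`CStarMatrix` is stated for a C⋆-algebra with a star order; the order used is the canonical one.) -/
noncomputable def cstarMatrixNorm {C : Type u} [NonUnitalCStarAlgebra C] {n : ℕ}
    (M : Matrix (Fin n) (Fin n) C) : ℝ :=
  letI : PartialOrder C := CStarAlgebra.spectralOrder C
  haveI : StarOrderedRing C := CStarAlgebra.spectralOrderedRing C
  ‖CStarMatrix.ofMatrix M‖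

section MorphismProperties

variable {B : Type u} [NonUnitalRing B] [Module ℂ B] [MatrixNorm B]
variable {C : Type v} [NonUnitalCStarAlgebra C]

/-- A homomorphism into a C⋆-algebra is completely contractive: all its entrywise amplifications
`M_n(B) → M_n(C)` are contractive. -/
def IsCompletelyContractive (π : B →ₙₐ[ℂ] C) : Prop :=
  ∀ (n : ℕ) (M : Matrix (Fin n) (Fin n) B), cstarMatrixNorm (M.map π) ≤ MatrixNorm.mnorm M

/-- A homomorphism into a C⋆-algebra is completely isometric: all its entrywise amplifications
`M_n(B) → M_n(C)` preserve the norm. -/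
def IsCompletelyIsometric (π : B →ₙₐ[ℂ] C) : Prop :=
  ∀ (n : ℕ) (M : Matrix (Fin n) (Fin n) B), cstarMatrixNorm (M.map π) = MatrixNorm.mnorm M

end MorphismProperties

/-- An operator algebra: a complete complex normed algebra (not necessarily unital) with matrix
norms, which has an isometric and completely isometric homomorphism into a C⋆-algebra. In other
words, up to completely isometric isomorphism, a closed subalgebra of a C⋆-algebra, with the
matrix norms inherited from that C⋆-algebra. -/
class OperatorAlgebra (B : Type u) extends NonUnitalNormedRing B, NormedSpace ℂ B,
    CompleteSpace B, MatrixNorm B where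
  exists_representation : ∃ (E : Type u) (_ : NonUnitalCStarAlgebra E) (ρ : B →ₙₐ[ℂ] E),
    (∀ b : B, ‖ρ b‖ = ‖b‖) ∧ IsCompletelyIsometric ρ

/-! ### C⋆-covers -/

/-- The C⋆-subalgebra generated by a subset of a C⋆-algebra. -/
def cstarGenerated {C : Type v} [NonUnitalCStarAlgebra C] (S : Set C) :
    NonUnitalStarSubalgebra ℂ C :=
  (NonUnitalStarAlgebra.adjoin ℂ S).topologicalClosure

instance cstarGenerated.isClosed {C : Type v} [NonUnitalCStarAlgebra C] (S : Set C) :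
    IsClosed (cstarGenerated S : Set C) :=
  isClosed_closure

theorem subset_cstarGenerated {C : Type v} [NonUnitalCStarAlgebra C] (S : Set C) :
    S ⊆ cstarGenerated S :=
  (NonUnitalStarAlgebra.subset_adjoin ℂ S).trans subset_closure

section Covers

variable {B : Type u} [NonUnitalRing B] [Module ℂ B] [MatrixNorm B]
variable {C : Type v} [NonUnitalCStarAlgebra C]

/-- `(C, j)` is a C⋆-cover of `B`: `j : B → C` is a completely isometric homomorphism whose range
generates `C` as a C⋆-algebra. -/
structure IsCStarCover (j : B →ₙₐ[ℂ] C) : Prop where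
  completelyIsometric : IsCompletelyIsometric j
  generates : cstarGenerated (Set.range j) = ⊤

/-- `(C, j)` is a maximal C⋆-cover of `B`, that is, `C = C⋆_max(B)`: it is a C⋆-cover, and every
completely contractive homomorphism from `B` into a C⋆-algebra extends to a `*`-homomorphism on
`C`. It is enough to consider C⋆-algebras in the universe of `B`, because the C⋆-subalgebra
generated by the image of `B` in any C⋆-algebra is isomorphic to one in that universe. -/
structure IsMaxCStarCover (j : B →ₙₐ[ℂ] C) : Prop extends IsCStarCover j where
  exists_extension : ∀ (F : Type u) [NonUnitalCStarAlgebra F] (π : B →ₙₐ[ℂ] F),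
    IsCompletelyContractive π → ∃ φ : C →⋆ₙₐ[ℂ] F, ∀ b : B, φ (j b) = π b

end Covers

/-! ### Closed ideals and their quotients -/

/-- A closed two-sided ideal of a normed algebra. -/
structure ClosedIdeal (B : Type u) [NonUnitalNormedRing B] [NormedSpace ℂ B] extends
    Submodule ℂ B where
  mul_mem_left' : ∀ (b : B) {a : B}, a ∈ carrier → b * a ∈ carrier
  mul_mem_right' : ∀ (b : B) {a : B}, a ∈ carrier → a * b ∈ carrier
  isClosed' : IsClosed carrier

namespace ClosedIdeal

section Basic

variable {B : Type u} [NonUnitalNormedRing B] [NormedSpace ℂ B]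

instance : SetLike (ClosedIdeal B) B where
  coe A := A.carrier
  coe_injective A A' h := by
    rcases A with ⟨A, _, _, _⟩
    rcases A' with ⟨A', _, _, _⟩
    congr
    exact SetLike.coe_injective h

instance : NonUnitalSubringClass (ClosedIdeal B) B where
  add_mem {A} _ _ h h' := A.toSubmodule.add_mem h h'
  zero_mem A := A.toSubmodule.zero_mem
  neg_mem {A} _ h := A.toSubmodule.neg_mem h
  mul_mem {A} b _ _ h' := A.mul_mem_left' b h'

instance : SMulMemClass (ClosedIdeal B) ℂ B where
  smul_mem {A} c _ h := A.toSubmodule.smul_mem c h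

/-- The matrix norms that an ideal of `B` inherits from `B`. -/
instance instMatrixNorm [MatrixNorm B] (A : ClosedIdeal B) : MatrixNorm A where
  mnorm M := MatrixNorm.mnorm (M.map (fun a : A => (a : B)))

/-- `A` is approximately unital: it has a contractive two-sided approximate identity. (A net
`(e_t)` is replaced by the filter it generates.) -/
def IsApproximatelyUnital (A : ClosedIdeal B) : Prop :=
  ∃ l : Filter A, l.IsApproximateUnit ∧ ∀ᶠ e in l, ‖e‖ ≤ 1

/-- The quotient algebra `B / A`. -/
def Quot (A : ClosedIdeal B) : Type u := B ⧸ A.toSubmodule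

variable (A : ClosedIdeal B)

instance : IsClosed (A.toSubmodule : Set B) := A.isClosed'

/-- The quotient norm. -/
noncomputable instance : NormedAddCommGroup A.Quot :=
  inferInstanceAs (NormedAddCommGroup (B ⧸ A.toSubmodule))

noncomputable instance : NormedSpace ℂ A.Quot :=
  inferInstanceAs (NormedSpace ℂ (B ⧸ A.toSubmodule))

instance [CompleteSpace B] : CompleteSpace A.Quot :=
  inferInstanceAs (CompleteSpace (B ⧸ A.toSubmodule))

/-- The quotient map `B → B / A`, as a linear map. -/
def mkₗ : B →ₗ[ℂ] A.Quot := A.toSubmodule.mkQ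

theorem mkₗ_surjective : Function.Surjective A.mkₗ := A.toSubmodule.mkQ_surjective

theorem mkₗ_eq_iff {x y : B} : A.mkₗ x = A.mkₗ y ↔ x - y ∈ A :=
  Submodule.Quotient.eq A.toSubmodule

theorem norm_mkₗ_le (x : B) : ‖A.mkₗ x‖ ≤ ‖x‖ :=
  Submodule.Quotient.norm_mk_le A.toSubmodule x

theorem exists_norm_lt (x : A.Quot) {r : ℝ} (h : ‖x‖ < r) : ∃ b : B, A.mkₗ b = x ∧ ‖b‖ < r := by
  obtain ⟨b, hb, hr⟩ :=
    Submodule.Quotient.norm_mk_lt (S := A.toSubmodule) x (sub_pos.2 h)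
  exact ⟨b, hb, hr.trans_eq (add_sub_cancel _ _)⟩

instance : Mul A.Quot where
  mul := Quotient.map₂ (· * ·) <| by
    intro a a' h b b' h'
    have h1 : a - a' ∈ A := (Submodule.quotientRel_def _).1 h
    have h2 : b - b' ∈ A := (Submodule.quotientRel_def _).1 h'
    refine (Submodule.quotientRel_def _).2 ?_
    have : a * b - a' * b' = a * (b - b') + (a - a') * b' := by noncomm_ring
    rw [this]
    exact A.toSubmodule.add_mem (A.mul_mem_left' _ h2) (A.mul_mem_right' _ h1)

theorem mkₗ_mul (x y : B) : A.mkₗ (x * y) = A.mkₗ x * A.mkₗ y := rfl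

noncomputable instance : NonUnitalNormedRing A.Quot where
  __ := (inferInstance : NormedAddCommGroup A.Quot)
  left_distrib := by
    intro x y z
    obtain ⟨x, rfl⟩ := A.mkₗ_surjective x
    obtain ⟨y, rfl⟩ := A.mkₗ_surjective y
    obtain ⟨z, rfl⟩ := A.mkₗ_surjective z
    simp only [← map_add, ← mkₗ_mul, mul_add]
  right_distrib := by
    intro x y z
    obtain ⟨x, rfl⟩ := A.mkₗ_surjective x
    obtain ⟨y, rfl⟩ := A.mkₗ_surjective y
    obtain ⟨z, rfl⟩ := A.mkₗ_surjective z
    simp only [← map_add, ← mkₗ_mul, add_mul]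
  zero_mul := by
    intro x
    obtain ⟨x, rfl⟩ := A.mkₗ_surjective x
    rw [← map_zero A.mkₗ, ← mkₗ_mul, zero_mul]
  mul_zero := by
    intro x
    obtain ⟨x, rfl⟩ := A.mkₗ_surjective x
    rw [← map_zero A.mkₗ, ← mkₗ_mul, mul_zero]
  mul_assoc := by
    intro x y z
    obtain ⟨x, rfl⟩ := A.mkₗ_surjective x
    obtain ⟨y, rfl⟩ := A.mkₗ_surjective y
    obtain ⟨z, rfl⟩ := A.mkₗ_surjective z
    simp only [← mkₗ_mul, mul_assoc]
  norm_mul_le := by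
    intro x y
    refine le_of_forall_gt_imp_ge_of_dense fun r hr => ?_
    have hc : Tendsto (fun t : ℝ => (‖x‖ + t) * (‖y‖ + t)) (𝓝[>] 0) (𝓝 (‖x‖ * ‖y‖)) := by
      have : Continuous fun t : ℝ => (‖x‖ + t) * (‖y‖ + t) := by fun_prop
      simpa using (this.tendsto 0).mono_left nhdsWithin_le_nhds
    obtain ⟨t, ht, ht0⟩ := ((hc.eventually_lt_const hr).and self_mem_nhdsWithin).exists
    have ht0 : 0 < t := ht0
    obtain ⟨a, rfl, ha⟩ := A.exists_norm_lt x (lt_add_of_pos_right _ ht0)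
    obtain ⟨b, rfl, hb⟩ := A.exists_norm_lt y (lt_add_of_pos_right _ ht0)
    calc ‖A.mkₗ a * A.mkₗ b‖ = ‖A.mkₗ (a * b)‖ := rfl
      _ ≤ ‖a * b‖ := A.norm_mkₗ_le _
      _ ≤ ‖a‖ * ‖b‖ := norm_mul_le _ _
      _ ≤ _ := by gcongr
      _ ≤ r := ht.le

/-- The quotient map `B → B / A`, as a homomorphism. -/
noncomputable def proj : B →ₙₐ[ℂ] A.Quot where
  toFun := A.mkₗ
  map_smul' c x := A.mkₗ.map_smul c x
  map_zero' := A.mkₗ.map_zero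
  map_add' x y := A.mkₗ.map_add x y
  map_mul' := A.mkₗ_mul

/-- The matrix norms of `B / A`: the quotient norms of `M_n(B) / M_n(A)`. -/
noncomputable instance instMatrixNormQuot [MatrixNorm B] : MatrixNorm A.Quot where
  mnorm X := sInf {r : ℝ | ∃ M, M.map A.proj = X ∧ MatrixNorm.mnorm M = r}

/-- The homomorphism `B / A → C / I` induced by a homomorphism `f : B → C` with `f(A) ⊆ I`. -/
noncomputable def quotMap {C : Type v} [NonUnitalNormedRing C] [NormedSpace ℂ C] (A : ClosedIdeal B)
    (I : ClosedIdeal C) (f : B →ₙₐ[ℂ] C) (h : ∀ a ∈ A, f a ∈ I) : A.Quot →ₙₐ[ℂ] I.Quot where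
  toFun := A.toSubmodule.mapQ I.toSubmodule (f : B →ₗ[ℂ] C) h
  map_smul' c x := map_smul (A.toSubmodule.mapQ I.toSubmodule (f : B →ₗ[ℂ] C) h) c x
  map_zero' := map_zero (A.toSubmodule.mapQ I.toSubmodule (f : B →ₗ[ℂ] C) h)
  map_add' x y := map_add (A.toSubmodule.mapQ I.toSubmodule (f : B →ₗ[ℂ] C) h) x y
  map_mul' x y := by
    obtain ⟨x, rfl⟩ := A.mkₗ_surjective x
    obtain ⟨y, rfl⟩ := A.mkₗ_surjective y
    exact congrArg I.proj (map_mul f x y)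

theorem quotMap_proj {C : Type v} [NonUnitalNormedRing C] [NormedSpace ℂ C] (A : ClosedIdeal B)
    (I : ClosedIdeal C) (f : B →ₙₐ[ℂ] C) (h : ∀ a ∈ A, f a ∈ I) (b : B) :
    quotMap A I f h (A.proj b) = I.proj (f b) := rfl

end Basic

end ClosedIdeal

/-- A closed two-sided ideal of a C⋆-algebra which is closed under the involution. (The last
condition is automatic.) -/
structure ClosedStarIdeal (C : Type u) [NonUnitalCStarAlgebra C] extends ClosedIdeal C where
  star_mem' : ∀ {a : C}, a ∈ carrier → star a ∈ carrier

namespace ClosedStarIdeal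

variable {C : Type u} [NonUnitalCStarAlgebra C]

instance : SetLike (ClosedStarIdeal C) C where
  coe I := I.carrier
  coe_injective I I' h := by
    rcases I with ⟨I, _⟩
    rcases I' with ⟨I', _⟩
    congr
    exact SetLike.coe_injective h

instance : NonUnitalSubringClass (ClosedStarIdeal C) C where
  add_mem {I} _ _ h h' := I.toSubmodule.add_mem h h'
  zero_mem I := I.toSubmodule.zero_mem
  neg_mem {I} _ h := I.toSubmodule.neg_mem h
  mul_mem {I} b _ _ h' := I.mul_mem_left' b h'

instance : SMulMemClass (ClosedStarIdeal C) ℂ C where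
  smul_mem {I} c _ h := I.toSubmodule.smul_mem c h

instance : StarMemClass (ClosedStarIdeal C) C where
  star_mem {I} _ h := I.star_mem' h

instance (I : ClosedStarIdeal C) : IsClosed (I : Set C) := I.isClosed'

/-- The quotient C⋆-algebra `C / I`. -/
abbrev Quot (I : ClosedStarIdeal C) : Type u := I.toClosedIdeal.Quot

variable (I : ClosedStarIdeal C)

noncomputable instance : StarRing I.Quot where
  star := Quotient.map star <| by
    intro a a' h
    have h1 : a - a' ∈ I := (Submodule.quotientRel_def _).1 h
    refine (Submodule.quotientRel_def _).2 ?_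
    rw [← star_sub]
    exact I.star_mem' h1
  star_involutive := by
    intro x
    obtain ⟨x, rfl⟩ := I.mkₗ_surjective x
    exact congrArg I.mkₗ (star_star x)
  star_mul := by
    intro x y
    obtain ⟨x, rfl⟩ := I.mkₗ_surjective x
    obtain ⟨y, rfl⟩ := I.mkₗ_surjective y
    exact congrArg I.mkₗ (star_mul x y)
  star_add := by
    intro x y
    obtain ⟨x, rfl⟩ := I.mkₗ_surjective x
    obtain ⟨y, rfl⟩ := I.mkₗ_surjective y
    exact congrArg I.mkₗ (star_add x y)

theorem mkₗ_star (x : C) : I.mkₗ (star x) = star (I.mkₗ x) := rfl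

/-- Compressing by `1 - e`, where `e` is a positive contraction, in terms of norms. -/
theorem norm_sub_mul_sq_le {e : C} (x d : C) (he : IsSelfAdjoint e)
    (he1 : ‖(1 : Unitization ℂ C) - e‖ ≤ 1) :
    ‖x - x * e‖ * ‖x - x * e‖ ≤ ‖star x * x + d‖ + ‖d - d * e‖ := by
  have h1 : ‖x - x * e‖ * ‖x - x * e‖ = ‖(1 - (e : Unitization ℂ C)) *
      ((star x * x : C) * (1 - (e : Unitization ℂ C)))‖ := by
    rw [← CStarRing.norm_star_mul_self, ← Unitization.norm_inr (𝕜 := ℂ)]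
    congr 1
    simp only [Unitization.inr_mul, Unitization.inr_sub, Unitization.inr_star, star_sub, star_mul,
      he.star_eq]
    noncomm_ring
  have h2 : ((star x * x : C) : Unitization ℂ C) * (1 - (e : Unitization ℂ C))
      = ((star x * x + d : C) : Unitization ℂ C) * (1 - (e : Unitization ℂ C))
        - ((d - d * e : C) : Unitization ℂ C) := by
    simp only [Unitization.inr_mul, Unitization.inr_sub, Unitization.inr_add]
    noncomm_ring
  rw [h1]
  calc _ ≤ ‖(1 - (e : Unitization ℂ C))‖ *
        ‖((star x * x : C) : Unitization ℂ C) * (1 - (e : Unitization ℂ C))‖ := norm_mul_le _ _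
    _ ≤ 1 * ‖((star x * x : C) : Unitization ℂ C) * (1 - (e : Unitization ℂ C))‖ := by gcongr
    _ ≤ ‖((star x * x + d : C) : Unitization ℂ C) * (1 - (e : Unitization ℂ C))‖
        + ‖((d - d * e : C) : Unitization ℂ C)‖ := by rw [one_mul, h2]; exact norm_sub_le _ _
    _ ≤ ‖((star x * x + d : C) : Unitization ℂ C)‖ * ‖1 - (e : Unitization ℂ C)‖
        + ‖((d - d * e : C) : Unitization ℂ C)‖ := by gcongr; exact norm_mul_le _ _
    _ ≤ ‖((star x * x + d : C) : Unitization ℂ C)‖ * 1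
        + ‖((d - d * e : C) : Unitization ℂ C)‖ := by gcongr
    _ = _ := by rw [mul_one, Unitization.norm_inr, Unitization.norm_inr]

theorem hom_nonneg {E : Type v} [NonUnitalCStarAlgebra E] {_ : PartialOrder E}
    (_ : StarOrderedRing E) [PartialOrder C] [StarOrderedRing C] (φ : E →⋆ₙₐ[ℂ] C) {a : E}
    (ha : 0 ≤ a) : 0 ≤ φ a :=
  map_nonneg φ ha

theorem norm_one_sub_le [PartialOrder C] [StarOrderedRing C] {e : C} (he : 0 ≤ e)
    (h' : ‖e‖ ≤ 1) : ‖(1 : Unitization ℂ C) - e‖ ≤ 1 := by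
  let _ : PartialOrder (Unitization ℂ C) := CStarAlgebra.spectralOrder _
  have _ : StarOrderedRing (Unitization ℂ C) := CStarAlgebra.spectralOrderedRing _
  have h0 : (0 : Unitization ℂ C) ≤ e := map_nonneg (Unitization.inrNonUnitalStarAlgHom ℂ C) he
  have h1 : (e : Unitization ℂ C) ≤ 1 := by
    rw [← CStarAlgebra.norm_le_one_iff_of_nonneg _ h0, Unitization.norm_inr]
    exact h'
  rw [CStarAlgebra.norm_le_one_iff_of_nonneg _ (sub_nonneg.2 h1)]
  exact sub_le_self _ h0

instance : CStarRing I.Quot where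
  norm_mul_self_le := by
    intro x
    obtain ⟨x, rfl⟩ := I.mkₗ_surjective x
    refine le_of_forall_gt_imp_ge_of_dense fun r hr => ?_
    obtain ⟨y, hy, hyr⟩ := I.exists_norm_lt _ hr
    have hd : y - star x * x ∈ I := I.mkₗ_eq_iff.1 hy
    let _ : PartialOrder C := CStarAlgebra.spectralOrder _
    have _ : StarOrderedRing C := CStarAlgebra.spectralOrderedRing _
    let _ : PartialOrder I := CStarAlgebra.spectralOrder _
    have _ : StarOrderedRing I := CStarAlgebra.spectralOrderedRing _
    have hu := CStarAlgebra.increasingApproximateUnit I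
    have _ := hu.neBot
    have ht : Tendsto (fun e : I => ‖y‖ + ‖(y - star x * x) - (y - star x * x) * (e : C)‖)
        (CStarAlgebra.approximateUnit I) (𝓝 ‖y‖) := by
      have h1 := (continuous_subtype_val.tendsto _).comp
        (hu.tendsto_mul_left (⟨y - star x * x, hd⟩ : I))
      have h2 := (tendsto_const_nhds (x := y - star x * x)).sub h1
      simpa using (h2.norm.const_add ‖y‖)
    obtain ⟨e, ⟨he0, he1⟩, her⟩ := ((hu.eventually_nonneg.and hu.eventually_norm).and
      (ht.eventually_lt_const hyr)).exists
    have hpos : 0 ≤ (e : C) := hom_nonneg (CStarAlgebra.spectralOrderedRing I)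
      (NonUnitalStarSubalgebraClass.subtype I) he0
    have hxe : I.mkₗ (x - x * (e : C)) = I.mkₗ x := by
      rw [I.mkₗ_eq_iff, sub_sub_cancel_left]
      exact neg_mem (I.mul_mem_left' x e.2)
    have key := norm_sub_mul_sq_le x (y - star x * x) hpos.isSelfAdjoint
      (norm_one_sub_le hpos he1)
    rw [add_sub_cancel] at key
    calc ‖I.mkₗ x‖ * ‖I.mkₗ x‖ ≤ ‖x - x * (e : C)‖ * ‖x - x * (e : C)‖ := by
          rw [← hxe]
          gcongr <;> exact I.norm_mkₗ_le _
      _ ≤ _ := key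
      _ ≤ r := her.le

noncomputable instance : NonUnitalCStarAlgebra I.Quot where
  smul_assoc c x y := by
    obtain ⟨x, rfl⟩ := I.mkₗ_surjective x
    obtain ⟨y, rfl⟩ := I.mkₗ_surjective y
    exact congrArg I.mkₗ (smul_mul_assoc c x y)
  smul_comm c x y := by
    obtain ⟨x, rfl⟩ := I.mkₗ_surjective x
    obtain ⟨y, rfl⟩ := I.mkₗ_surjective y
    exact congrArg I.mkₗ (mul_smul_comm c x y).symm
  star_smul c x := by
    obtain ⟨x, rfl⟩ := I.mkₗ_surjective x
    exact congrArg I.mkₗ (star_smul c x)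

end ClosedStarIdeal

/-- The restriction of a homomorphism `j : B → C` to an ideal `A` of `B`, as a homomorphism into
the C⋆-subalgebra of `C` generated by `j(A)`. -/
def ClosedIdeal.restrict {B : Type u} [NonUnitalNormedRing B] [NormedSpace ℂ B] {C : Type v}
    [NonUnitalCStarAlgebra C] (A : ClosedIdeal B) (j : B →ₙₐ[ℂ] C) :
    A →ₙₐ[ℂ] cstarGenerated (j '' A) where
  toFun a := ⟨j a, subset_cstarGenerated _ (Set.mem_image_of_mem j a.2)⟩
  map_smul' c a := Subtype.ext (map_smul j c (a : B))
  map_zero' := Subtype.ext (map_zero j)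
  map_add' a b := Subtype.ext (map_add j (a : B) b)
  map_mul' a b := Subtype.ext (map_mul j (a : B) b)

-- Write `D` for the C⋆-algebra generated by `j(A)` and `(e)` for the contractive approximate
-- identity of `A`. The basic fact is that `j(e)` is a two-sided approximate identity for all of
-- `D`, adjoints included (`tendsto_of_mem_cstarGenerated`). Since `j(b) j(e) d = j(be) d` with `be
-- ∈ A`, passing to the limit shows that `D` is an ideal.
--
-- For the first claim, let `π` be completely contractive on `A` and let `G` be the C⋆-algebra
-- generated by `π(A)`. Then `π` is nondegenerate in `G` and extends to `σ : B → 𝓜(ℂ, G)`, where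
-- `σ(b)` is the strict limit of `π(be)`; it is completely contractive because `π(e) σ(b) = π(eb)`.
-- Maximality of the cover of `B` extends `σ` to a `*`-homomorphism, and this maps `D` into `G`
-- because it maps `j(A)` there.
--
-- For the second claim, the universal property is formal: a homomorphism on `B/A`, pulled back to
-- `B` and extended, kills `j(A)` and hence `D`. The substance is that `B/A → C/D` does not decrease
-- matrix norms. A positive approximate unit `(f)` of the ideal computes the quotient norm as a
-- limit of `‖c - c f‖`, but `f` need not come from `A`; the elements `e` do, but `1 - e` need not
-- be a contraction. Averaging reconciles the two: choose pairs `(e_k, f_k)` successively so that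
-- each `e_k - f_k` is almost orthogonal to the sum of the previous differences. The sum of `N`
-- differences then has norm at most `√(5N)`, so the averages of the `e_k` and of the `f_k` are
-- asymptotically equal, and the former compute the quotient norm from within `A`.

attribute [local instance] CStarAlgebra.spectralOrder CStarAlgebra.spectralOrderedRing

/-! ### Norms of matrices over a C⋆-algebra -/

section MatrixNorms

variable {C : Type u} [NonUnitalCStarAlgebra C] {E : Type v} [NonUnitalCStarAlgebra E] {n : ℕ}

theorem cstarMatrixNorm_eq (M : Matrix (Fin n) (Fin n) C) :
    cstarMatrixNorm M = ‖CStarMatrix.ofMatrix M‖ := rfl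

theorem cstarMatrixNorm_nonneg (M : Matrix (Fin n) (Fin n) C) : 0 ≤ cstarMatrixNorm M :=
  norm_nonneg (CStarMatrix.ofMatrix M)

theorem cstarMatrixNorm_map_le (φ : C →⋆ₙₐ[ℂ] E) (M : Matrix (Fin n) (Fin n) C) :
    cstarMatrixNorm (M.map φ) ≤ cstarMatrixNorm M :=
  NonUnitalStarAlgHom.norm_apply_le (CStarMatrix.mapₙₐ (n := Fin n) φ) (CStarMatrix.ofMatrix M)

theorem cstarMatrixNorm_map_of_injective (φ : C →⋆ₙₐ[ℂ] E) (hφ : Function.Injective φ)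
    (M : Matrix (Fin n) (Fin n) C) : cstarMatrixNorm (M.map φ) = cstarMatrixNorm M :=
  NonUnitalStarAlgHom.norm_map (CStarMatrix.mapₙₐ (n := Fin n) φ)
    (fun _ _ h => CStarMatrix.map_injective hφ h) (CStarMatrix.ofMatrix M)

/-- The `*`-homomorphism sending an element to the corresponding scalar matrix. -/
def CStarMatrix.scalarHom (n : ℕ) (C : Type u) [NonUnitalCStarAlgebra C] :
    C →⋆ₙₐ[ℂ] CStarMatrix (Fin n) (Fin n) C where
  toFun c := CStarMatrix.ofMatrix (Matrix.diagonal fun _ => c)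
  map_smul' r c := by
    ext i k
    simp only [CStarMatrix.ofMatrix_apply, CStarMatrix.smul_apply, Matrix.diagonal_apply]
    split_ifs <;> simp
  map_zero' := by
    ext i k
    simp [CStarMatrix.ofMatrix_apply]
  map_add' c d := by
    ext i k
    simp only [CStarMatrix.ofMatrix_apply, CStarMatrix.add_apply, Matrix.diagonal_apply]
    split_ifs <;> simp
  map_mul' c d := by
    ext i k
    simp only [CStarMatrix.ofMatrix_apply, CStarMatrix.mul_apply, Matrix.diagonal_apply]
    rw [Finset.sum_eq_single i (fun x _ hx => by simp [hx.symm]) (by simp)]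
    simp
  map_star' c := by
    ext i k
    simp only [CStarMatrix.ofMatrix_apply, CStarMatrix.star_apply, Matrix.diagonal_apply]
    by_cases h : i = k
    · simp [h]
    · simp [h, Ne.symm h]

theorem cstarMatrixNorm_one_by_one (c : C) :
    cstarMatrixNorm (Matrix.of fun _ _ : Fin 1 => c) = ‖c‖ := by
  have h : CStarMatrix.ofMatrix (Matrix.of fun _ _ : Fin 1 => c) = CStarMatrix.scalarHom 1 C c := by
    ext i k
    exact ((congrArg (Matrix.diagonal (fun _ : Fin 1 => c) i) (Subsingleton.elim k i)).trans
      (Matrix.diagonal_apply_eq _ i)).symm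
  rw [cstarMatrixNorm_eq, h]
  refine NonUnitalStarAlgHom.norm_map _ (fun x y hxy => ?_) c
  exact (Matrix.diagonal_apply_eq (fun _ : Fin 1 => x) 0).symm.trans
    ((congrFun (congrFun hxy 0) 0).trans (Matrix.diagonal_apply_eq (fun _ : Fin 1 => y) 0))

theorem CStarMatrix.scalarHom_mul_apply (c : C) (M : CStarMatrix (Fin n) (Fin n) C)
    (i k : Fin n) : (CStarMatrix.scalarHom n C c * M) i k = c * M i k :=
  Matrix.diagonal_mul (fun _ => c) M i k

theorem CStarMatrix.mul_scalarHom_apply (c : C) (M : CStarMatrix (Fin n) (Fin n) C)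
    (i k : Fin n) : (M * CStarMatrix.scalarHom n C c) i k = M i k * c :=
  Matrix.mul_diagonal (fun _ => c) M i k

theorem cstarMatrixNorm_const_mul_le (c : C) (M : Matrix (Fin n) (Fin n) C) :
    cstarMatrixNorm (M.map (c * ·)) ≤ ‖c‖ * cstarMatrixNorm M := by
  have h : CStarMatrix.ofMatrix (M.map (c * ·)) =
      CStarMatrix.scalarHom n C c * CStarMatrix.ofMatrix M := by
    ext i k
    rw [CStarMatrix.scalarHom_mul_apply]
    rfl
  rw [cstarMatrixNorm_eq, h]
  exact (norm_mul_le _ _).trans (mul_le_mul_of_nonneg_right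
    (NonUnitalStarAlgHom.norm_apply_le _ c) (norm_nonneg _))

end MatrixNorms

/-! ### Matrix norms of an operator algebra -/

section OperatorAlgebra

variable {B : Type u} [OperatorAlgebra B]

theorem OperatorAlgebra.mnorm_one_by_one (b : B) :
    MatrixNorm.mnorm (Matrix.of fun _ _ : Fin 1 => b) = ‖b‖ := by
  obtain ⟨E, _, ρ, h1, h2⟩ := OperatorAlgebra.exists_representation (B := B)
  rw [← h2, ← h1]
  exact cstarMatrixNorm_one_by_one (ρ b)

theorem OperatorAlgebra.mnorm_nonneg {n : ℕ} (M : Matrix (Fin n) (Fin n) B) :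
    0 ≤ MatrixNorm.mnorm M := by
  obtain ⟨E, _, ρ, h1, h2⟩ := OperatorAlgebra.exists_representation (B := B)
  rw [← h2]
  exact cstarMatrixNorm_nonneg _

theorem OperatorAlgebra.mnorm_const_mul_le {n : ℕ} (b : B) (M : Matrix (Fin n) (Fin n) B) :
    MatrixNorm.mnorm (M.map (b * ·)) ≤ ‖b‖ * MatrixNorm.mnorm M := by
  obtain ⟨E, _, ρ, h1, h2⟩ := OperatorAlgebra.exists_representation (B := B)
  rw [← h2, ← h2, ← h1]
  have : (M.map (b * ·)).map ρ = (M.map ρ).map (ρ b * ·) := by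
    ext i k
    simp
  rw [this]
  exact cstarMatrixNorm_const_mul_le _ _

/-- Compatibility of scalars with products is not an axiom of the class; it is pulled back along the
isometric representation. -/
theorem OperatorAlgebra.smul_mul (c : ℂ) (x y : B) : (c • x) * y = c • (x * y) := by
  obtain ⟨E, _, ρ, h1, -⟩ := OperatorAlgebra.exists_representation (B := B)
  rw [← sub_eq_zero, ← norm_eq_zero, ← h1]
  simp [smul_mul_assoc]

variable {C : Type v} [NonUnitalCStarAlgebra C]

theorem IsCompletelyIsometric.norm_map {j : B →ₙₐ[ℂ] C} (hj : IsCompletelyIsometric j) (b : B) :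
    ‖j b‖ = ‖b‖ := by
  rw [← OperatorAlgebra.mnorm_one_by_one, ← hj]
  exact (cstarMatrixNorm_one_by_one (j b)).symm

theorem ClosedIdeal.norm_map_le {A : ClosedIdeal B} {π : A →ₙₐ[ℂ] C}
    (hπ : IsCompletelyContractive π) (a : A) : ‖π a‖ ≤ ‖a‖ := by
  have h := hπ 1 (Matrix.of fun _ _ => a)
  have h1 : MatrixNorm.mnorm (Matrix.of fun _ _ : Fin 1 => a) = ‖a‖ :=
    OperatorAlgebra.mnorm_one_by_one (a : B)
  rw [← h1]
  exact (cstarMatrixNorm_one_by_one (π a)).symm.trans_le h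

end OperatorAlgebra

/-! ### Contractive approximate units -/

section ApproximateUnits

theorem tendsto_of_mem_closure_of_dist_le {ι : Type*} {E : Type*} [PseudoMetricSpace E]
    {l : Filter ι} {T : ι → E → E} (hT : ∀ᶠ i in l, ∀ x y, dist (T i x) (T i y) ≤ dist x y)
    {S : Set E} (hS : ∀ x ∈ S, Tendsto (fun i => T i x) l (𝓝 x)) {x : E} (hx : x ∈ closure S) :
    Tendsto (fun i => T i x) l (𝓝 x) := by
  rw [Metric.tendsto_nhds]
  intro ε hε
  obtain ⟨y, hy, hxy⟩ := Metric.mem_closure_iff.1 hx (ε / 3) (by positivity)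
  filter_upwards [hT, Metric.tendsto_nhds.1 (hS y hy) (ε / 3) (by positivity)] with i hi hi'
  have h1 := dist_triangle4 (T i x) (T i y) y x
  have h2 := hi x y
  rw [dist_comm y x] at h1
  linarith

variable {C : Type u} [NonUnitalCStarAlgebra C]

/-- Expanding `(a - a e*)(a - a e*)*` gives the term `a e* e a*`, which is at most `a a*` because
`e` is a contraction. What remains is `(a - a e) a* + a (a - a e)*`, which is small when `a e` is
close to `a`. -/
theorem norm_sub_mul_star_sq_le (a : C) {e : C} (he : ‖e‖ ≤ 1) :
    ‖a - a * star e‖ ^ 2 ≤ 2 * ‖a‖ * ‖a - a * e‖ := by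
  have h1 : ‖a - a * star e‖ ^ 2 =
      ‖(a - a * star e) * star (a - a * star e)‖ := by
    rw [CStarRing.norm_self_mul_star, sq]
  have h2 : (a - a * star e) * star (a - a * star e) ≤
      (a - a * e) * star a + a * star (a - a * e) := by
    have h3 : a * (star e * e) * star a ≤ a * star a := by
      refine (CStarAlgebra.star_right_conjugate_le_norm_smul (IsSelfAdjoint.star_mul_self e)).trans
        ?_
      calc ‖star e * e‖ • (a * star a) ≤ (1 : ℝ) • (a * star a) := by
            refine smul_le_smul_of_nonneg_right ?_ (mul_star_self_nonneg a)
            rw [CStarRing.norm_star_mul_self]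
            exact mul_le_one₀ he (norm_nonneg _) he
        _ = a * star a := one_smul _ _
    have h4 : (a - a * e) * star a + a * star (a - a * e) -
        (a - a * star e) * star (a - a * star e) = a * star a - a * (star e * e) * star a := by
      simp only [star_sub, star_mul, star_star]
      noncomm_ring
    rw [← sub_nonneg, h4, sub_nonneg]
    exact h3
  rw [h1]
  calc _ ≤ ‖(a - a * e) * star a + a * star (a - a * e)‖ :=
        CStarAlgebra.norm_le_norm_of_nonneg_of_le (mul_star_self_nonneg _) h2
    _ ≤ ‖a - a * e‖ * ‖a‖ + ‖a‖ * ‖a - a * e‖ := by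
        refine (norm_add_le _ _).trans (add_le_add ?_ ?_) <;>
        exact (norm_mul_le _ _).trans_eq (by rw [norm_star])
    _ = _ := by ring

variable {ι : Type*} {l : Filter ι} {e : ι → C}

theorem tendsto_mul_star (he : ∀ᶠ i in l, ‖e i‖ ≤ 1) {a : C}
    (ha : Tendsto (fun i => a * e i) l (𝓝 a)) : Tendsto (fun i => a * star (e i)) l (𝓝 a) := by
  rw [tendsto_iff_norm_sub_tendsto_zero]
  have h1 : Tendsto (fun i => 2 * ‖a‖ * ‖a - a * e i‖) l (𝓝 0) := by
    have := (tendsto_const_nhds (x := a)).sub ha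
    simpa using (this.norm.const_mul (2 * ‖a‖))
  have h2 : Tendsto (fun i => ‖a * star (e i) - a‖ ^ 2) l (𝓝 0) := by
    refine squeeze_zero' (Eventually.of_forall fun i => by positivity) ?_ h1
    filter_upwards [he] with i hi
    rw [norm_sub_rev]
    exact norm_sub_mul_star_sq_le a hi
  have h3 := (Real.continuous_sqrt.tendsto 0).comp h2
  simpa [Function.comp_def, Real.sqrt_sq] using h3

theorem tendsto_mul_star_self (he : ∀ᶠ i in l, ‖e i‖ ≤ 1) {a : C}
    (ha : Tendsto (fun i => a * e i) l (𝓝 a)) : Tendsto (fun i => e i * star a) l (𝓝 (star a)) := by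
  simpa using (tendsto_mul_star he ha).star

theorem tendsto_star_mul (he : ∀ᶠ i in l, ‖e i‖ ≤ 1) {a : C}
    (ha : Tendsto (fun i => e i * a) l (𝓝 a)) : Tendsto (fun i => star a * e i) l (𝓝 (star a)) := by
  have h : ∀ᶠ i in l, ‖star (e i)‖ ≤ 1 := by simpa using he
  simpa using tendsto_mul_star h (a := star a) (by simpa using ha.star)

/-- Both sides are carried through the induction because taking adjoints exchanges them.
Contractivity of the `e i` is used twice: for adjoints and for the passage to the closure. -/
theorem tendsto_of_mem_cstarGenerated (he : ∀ᶠ i in l, ‖e i‖ ≤ 1) {S : Set C}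
    (hl : ∀ s ∈ S, Tendsto (fun i => e i * s) l (𝓝 s))
    (hr : ∀ s ∈ S, Tendsto (fun i => s * e i) l (𝓝 s)) {d : C} (hd : d ∈ cstarGenerated S) :
    Tendsto (fun i => e i * d) l (𝓝 d) ∧ Tendsto (fun i => d * e i) l (𝓝 d) := by
  have key : ∀ d ∈ NonUnitalStarAlgebra.adjoin ℂ S,
      Tendsto (fun i => e i * d) l (𝓝 d) ∧ Tendsto (fun i => d * e i) l (𝓝 d) := by
    intro d hd
    induction hd using NonUnitalStarAlgebra.adjoin_induction with
    | mem x hx => exact ⟨hl x hx, hr x hx⟩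
    | add x y _ _ hx hy =>
      exact ⟨by simpa only [mul_add] using hx.1.add hy.1,
        by simpa only [add_mul] using hx.2.add hy.2⟩
    | zero => simp [tendsto_const_nhds]
    | mul x y _ _ hx hy =>
      exact ⟨by simpa only [mul_assoc] using hx.1.mul_const y,
        by simpa only [mul_assoc] using hy.2.const_mul x⟩
    | smul r x _ hx =>
      exact ⟨by simpa only [mul_smul_comm] using hx.1.const_smul r,
        by simpa only [smul_mul_assoc] using hx.2.const_smul r⟩
    | star x _ hx => exact ⟨tendsto_mul_star_self he hx.2, tendsto_star_mul he hx.1⟩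
  have hd' : d ∈ closure (NonUnitalStarAlgebra.adjoin ℂ S : Set C) := hd
  refine ⟨tendsto_of_mem_closure_of_dist_le (T := fun i x => e i * x) ?_
    (fun x hx => (key x hx).1) hd', tendsto_of_mem_closure_of_dist_le (T := fun i x => x * e i) ?_
    (fun x hx => (key x hx).2) hd'⟩
  · filter_upwards [he] with i hi x y
    rw [dist_eq_norm, dist_eq_norm, ← mul_sub]
    exact (norm_mul_le _ _).trans (mul_le_of_le_one_left (norm_nonneg _) hi)
  · filter_upwards [he] with i hi x y
    rw [dist_eq_norm, dist_eq_norm, ← sub_mul]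
    exact (norm_mul_le _ _).trans (mul_le_of_le_one_right (norm_nonneg _) hi)

end ApproximateUnits

/-! ### Distances to closed ideals of C⋆-algebras -/

namespace ClosedStarIdeal

variable {C : Type u} [NonUnitalCStarAlgebra C] (I : ClosedStarIdeal C)

theorem norm_sub_mul_le_of_nonneg (x : C) {f : C} (hf : 0 ≤ f) (hf1 : ‖f‖ ≤ 1) :
    ‖x - x * f‖ ≤ ‖x‖ := by
  rw [← Unitization.norm_inr (𝕜 := ℂ), ← Unitization.norm_inr (𝕜 := ℂ) (a := x)]
  have h : ((x - x * f : C) : Unitization ℂ C) = x * (1 - (f : Unitization ℂ C)) := by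
    simp only [Unitization.inr_mul, Unitization.inr_sub]
    noncomm_ring
  rw [h]
  exact (norm_mul_le _ _).trans
    (mul_le_of_le_one_right (norm_nonneg _) (norm_one_sub_le hf hf1))

/-- A closed ideal has a positive contractive approximate unit, and it computes the quotient
norm. -/
theorem exists_approximateUnit : ∃ l : Filter C, l.NeBot ∧ (∀ᶠ f in l, f ∈ I ∧ ‖f‖ ≤ 1) ∧
    (∀ d ∈ I, Tendsto (fun f => d * f) l (𝓝 d)) ∧
    ∀ (c : C) (r : ℝ), ‖I.mkₗ c‖ < r → ∀ᶠ f in l, ‖c - c * f‖ < r := by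
  let _ : PartialOrder I := CStarAlgebra.spectralOrder _
  have _ : StarOrderedRing I := CStarAlgebra.spectralOrderedRing _
  have hu := CStarAlgebra.increasingApproximateUnit I
  have _ := hu.neBot
  have hI : ∀ d ∈ I, Tendsto (fun f : I => d * (f : C)) (CStarAlgebra.approximateUnit I) (𝓝 d) :=
    fun d hd => (continuous_subtype_val.tendsto _).comp (hu.tendsto_mul_left (⟨d, hd⟩ : I))
  refine ⟨(CStarAlgebra.approximateUnit I).map (fun f : I => (f : C)), inferInstance, ?_,
    fun d hd => tendsto_map'_iff.2 (hI d hd), ?_⟩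
  · rw [eventually_map]
    filter_upwards [hu.eventually_norm] with f hf using ⟨f.2, hf⟩
  · intro c r hr
    obtain ⟨c', hc', hr'⟩ := I.exists_norm_lt _ hr
    have hd : c - c' ∈ I := I.mkₗ_eq_iff.1 hc'.symm
    have ht : Tendsto (fun f : I => ‖c'‖ + ‖(c - c') - (c - c') * (f : C)‖)
        (CStarAlgebra.approximateUnit I) (𝓝 ‖c'‖) := by
      simpa using ((tendsto_const_nhds (x := c - c')).sub (hI _ hd)).norm.const_add ‖c'‖
    rw [eventually_map]
    filter_upwards [hu.eventually_nonneg, hu.eventually_norm, ht.eventually_lt_const hr']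
      with f hf0 hf1 hf
    have hpos : 0 ≤ (f : C) := hom_nonneg (CStarAlgebra.spectralOrderedRing I)
      (NonUnitalStarSubalgebraClass.subtype I) hf0
    refine lt_of_le_of_lt ?_ hf
    have h : c - c * (f : C) = (c' - c' * f) + ((c - c') - (c - c') * f) := by noncomm_ring
    rw [h]
    exact (norm_add_le _ _).trans (by gcongr; exact norm_sub_mul_le_of_nonneg c' hpos hf1)

/-- A Pythagorean estimate for nearly orthogonal elements: in `(y + x)* (y + x)` the two cross terms
contribute at most `1/2 + 1/2` and `x* x` at most `4`. -/
theorem norm_add_sq_le {y x : C} (hx : ‖x‖ ≤ 2) (hyx : ‖star y * x‖ ≤ 1 / 2) :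
    ‖y + x‖ ^ 2 ≤ ‖y‖ ^ 2 + 5 := by
  have h : star (y + x) * (y + x) = star y * y + star y * x + star (star y * x) + star x * x := by
    simp only [star_add, star_mul, star_star]
    noncomm_ring
  rw [sq, ← CStarRing.norm_star_mul_self, h]
  have h1 := norm_add_le (star y * y + star y * x + star (star y * x)) (star x * x)
  have h2 := norm_add_le (star y * y + star y * x) (star (star y * x))
  have h3 := norm_add_le (star y * y) (star y * x)
  rw [norm_star] at h2
  rw [CStarRing.norm_star_mul_self] at h1 h3
  nlinarith [norm_nonneg x]

variable {I} {ι : Type*} {l : Filter ι} [l.NeBot] {e : ι → C}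

/-- The averages of a contractive approximate unit approach averages of a positive one. -/
theorem exists_norm_sub_sq_le (he : ∀ᶠ i in l, e i ∈ I ∧ ‖e i‖ ≤ 1)
    (hd : ∀ d ∈ I, Tendsto (fun i => d * e i) l (𝓝 d)) {S : Submodule ℂ C}
    (hS : ∀ᶠ i in l, e i ∈ S) {c : C} {r : ℝ} (hr : ‖I.mkₗ c‖ < r) (N : ℕ) :
    ∃ E ∈ S, ∃ F ∈ I, E ∈ I ∧ ‖E - F‖ ^ 2 ≤ 5 * N ∧ ‖(N : ℂ) • c - c * F‖ ≤ N * r := by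
  obtain ⟨l', _, hf, hd', hc⟩ := I.exists_approximateUnit
  induction N with
  | zero => exact ⟨0, S.zero_mem, 0, zero_mem I, zero_mem I, by simp, by simp⟩
  | succ N ih =>
    obtain ⟨E, hES, F, hF, hE, hEF, hcF⟩ := ih
    have hy : star (E - F) ∈ I := star_mem (sub_mem hE hF)
    -- Near-orthogonality: `star (E - F)` lies in `I`, where both nets act as right approximate
    -- units, so its products with `e i` and with `f` have the same limit.
    have ht : Tendsto (fun p : ι × C => ‖star (E - F) * (e p.1 - p.2)‖) (l ×ˢ l') (𝓝 0) := by
      have := (((hd _ hy).comp tendsto_fst).sub ((hd' _ hy).comp tendsto_snd) :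
        Tendsto _ (l ×ˢ l') _)
      simpa [mul_sub] using this.norm
    obtain ⟨⟨i, f⟩, ⟨⟨⟨hi, hi1⟩, hiS⟩, ⟨hf, hf1⟩, hcf⟩, hif⟩ :=
      (((he.and hS).prod_mk (hf.and (hc c r hr))).and
        (ht.eventually_lt_const (show (0 : ℝ) < 1 / 2 by norm_num))).exists
    refine ⟨E + e i, S.add_mem hES hiS, F + f, add_mem hF hf, add_mem hE hi, ?_, ?_⟩
    · rw [add_sub_add_comm]
      have := norm_add_sq_le (y := E - F) (x := e i - f)
        ((norm_sub_le _ _).trans (by simp only at hi1 hf1; linarith)) hif.le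
      push_cast
      linarith
    · have h : ((N + 1 : ℕ) : ℂ) • c - c * (F + f) = ((N : ℂ) • c - c * F) + (c - c * f) := by
        push_cast
        rw [add_smul, one_smul, mul_add]
        abel
      rw [h]
      refine (norm_add_le _ _).trans ?_
      push_cast
      have : ‖c - c * f‖ < r := hcf
      linarith

/-- Dividing the sums by `N` leaves an error of at most `‖c‖ √(5 / N)` from replacing the positive
elements by the `e i`. The witness lies in `S` itself, with no closure taken. -/
theorem exists_norm_sub_mul_lt (he : ∀ᶠ i in l, e i ∈ I ∧ ‖e i‖ ≤ 1)
    (hd : ∀ d ∈ I, Tendsto (fun i => d * e i) l (𝓝 d)) {S : Submodule ℂ C}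
    (hS : ∀ᶠ i in l, e i ∈ S) {c : C} {r : ℝ} (hr : ‖I.mkₗ c‖ < r) :
    ∃ E ∈ S, ‖c - c * E‖ < r := by
  obtain ⟨s, hs, hsr⟩ := exists_between hr
  -- This is the condition `‖c‖ √(5N) < N (r - s)`, so that the error fits into the gap between `s`
  -- and `r`.
  obtain ⟨N, hN⟩ := exists_nat_gt (5 * ‖c‖ ^ 2 / (r - s) ^ 2)
  have hδ : 0 < r - s := sub_pos.2 hsr
  have hN0 : (0 : ℝ) < N := lt_of_le_of_lt (by positivity) hN
  obtain ⟨E, hES, F, -, -, hEF, hcF⟩ := exists_norm_sub_sq_le he hd hS hs N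
  refine ⟨(N : ℂ)⁻¹ • E, S.smul_mem _ hES, ?_⟩
  have h1 : (N : ℂ) • (c - c * ((N : ℂ)⁻¹ • E)) = ((N : ℂ) • c - c * F) - c * (E - F) := by
    have : (N : ℂ) ≠ 0 := by exact_mod_cast hN0.ne'
    rw [smul_sub, mul_smul_comm, smul_inv_smul₀ this, mul_sub]
    abel
  have h2 : ‖c‖ * ‖E - F‖ < N * (r - s) := by
    refine lt_of_pow_lt_pow_left₀ 2 (by positivity) ?_
    rw [div_lt_iff₀ (by positivity)] at hN
    calc (‖c‖ * ‖E - F‖) ^ 2 = ‖c‖ ^ 2 * ‖E - F‖ ^ 2 := mul_pow _ _ _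
      _ ≤ ‖c‖ ^ 2 * (5 * N) := by gcongr
      _ = N * (5 * ‖c‖ ^ 2) := by ring
      _ < N * (N * (r - s) ^ 2) := by gcongr
      _ = _ := by ring
  have h3 : (N : ℝ) * ‖c - c * ((N : ℂ)⁻¹ • E)‖ < N * r := by
    have h4 : (N : ℝ) * ‖c - c * ((N : ℂ)⁻¹ • E)‖ = ‖(N : ℂ) • (c - c * ((N : ℂ)⁻¹ • E))‖ := by
      rw [norm_smul, Complex.norm_natCast]
    rw [h4, h1]
    have := norm_sub_le ((N : ℂ) • c - c * F) (c * (E - F))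
    have := norm_mul_le c (E - F)
    linarith
  exact lt_of_mul_lt_mul_left h3 hN0.le

end ClosedStarIdeal

/-! ### Multiplier algebras -/

open scoped MultiplierAlgebra

namespace DoubleCentralizer

variable {G : Type u} [NonUnitalCStarAlgebra G]

/-- The norm of a double centralizer is the norm of its left part, so the left part determines it.
-/
theorem eq_of_fst_eq {m m' : 𝓜(ℂ, G)} (h : ∀ g, m.fst g = m'.fst g) : m = m' := by
  rw [← sub_eq_zero, ← norm_eq_zero, ← DoubleCentralizer.norm_fst, DoubleCentralizer.sub_fst,
    show m.fst = m'.fst from ContinuousLinearMap.ext h, sub_self, norm_zero]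

theorem norm_coe (g : G) : ‖(g : 𝓜(ℂ, G))‖ = ‖g‖ := by
  rw [← DoubleCentralizer.norm_fst, DoubleCentralizer.coe_fst,
    ContinuousLinearMap.opNorm_mul_apply]

theorem coe_mul (g h : G) : ((g * h : G) : 𝓜(ℂ, G)) = g * h :=
  map_mul (DoubleCentralizer.coeHom (𝕜 := ℂ)) g h

theorem coe_injective : Function.Injective (DoubleCentralizer.coe ℂ : G → 𝓜(ℂ, G)) :=
  (NonUnitalStarAlgHom.isometry (DoubleCentralizer.coeHom (𝕜 := ℂ) (A := G)) <|
    (injective_iff_map_eq_zero _).2 fun g hg => by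
      rw [← norm_eq_zero, ← norm_coe]
      exact norm_eq_zero.2 hg).injective

theorem continuous_coe : Continuous (DoubleCentralizer.coe ℂ : G → 𝓜(ℂ, G)) :=
  (AddMonoidHomClass.isometry_of_norm (DoubleCentralizer.coeHom (𝕜 := ℂ) (A := G))
    norm_coe).continuous

theorem coe_mul_eq (g : G) (m : 𝓜(ℂ, G)) : (g : 𝓜(ℂ, G)) * m = (m.snd g : G) :=
  eq_of_fst_eq fun h => (m.central g h).symm

open scoped WithCStarModule

/-- The left action of a multiplier on vectors with entries in the multiplier algebra. -/
noncomputable def smulVec {n : ℕ} (a : 𝓜(ℂ, G)) (v : C⋆ᵐᵒᵈ(𝓜(ℂ, G), Fin n → 𝓜(ℂ, G))) :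
    C⋆ᵐᵒᵈ(𝓜(ℂ, G), Fin n → 𝓜(ℂ, G)) :=
  (WithCStarModule.equiv _ _).symm fun k => a * v k

theorem norm_smulVec_le {n : ℕ} (a : 𝓜(ℂ, G)) (v : C⋆ᵐᵒᵈ(𝓜(ℂ, G), Fin n → 𝓜(ℂ, G))) :
    ‖smulVec a v‖ ≤ ‖a‖ * ‖v‖ := by
  refine le_of_sq_le_sq ?_ (by positivity)
  have h : inner 𝓜(ℂ, G) (smulVec a v) (smulVec a v) = a * inner 𝓜(ℂ, G) v v * star a := by
    simp only [WithCStarModule.pi_inner, smulVec, WithCStarModule.equiv_symm_pi_apply,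
      WithCStarModule.inner_def, star_mul, Finset.mul_sum, Finset.sum_mul, mul_assoc]
  rw [CStarModule.norm_sq_eq 𝓜(ℂ, G), h, mul_pow, CStarModule.norm_sq_eq 𝓜(ℂ, G) (x := v)]
  calc _ ≤ ‖a‖ * ‖inner 𝓜(ℂ, G) v v‖ * ‖star a‖ :=
        (norm_mul_le _ _).trans (by gcongr; exact norm_mul_le _ _)
    _ = _ := by rw [norm_star]; ring

/-- The norm of a vector over the multiplier algebra is determined by its products with elements
of the algebra. -/
theorem norm_vec_le {n : ℕ} (w : C⋆ᵐᵒᵈ(𝓜(ℂ, G), Fin n → 𝓜(ℂ, G))) {K : ℝ} (hK : 0 ≤ K)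
    (h : ∀ g : G, ‖smulVec (g : 𝓜(ℂ, G)) w‖ ≤ K * ‖g‖) : ‖w‖ ≤ K := by
  -- The norm of a multiplier is tested on `g ∈ G`: here `g ⟨w, w⟩ = ⟨w, g w⟩`, and Cauchy–Schwarz
  -- applies. Cancelling one factor `‖w‖` then gives the claim.
  have h1 : ‖inner 𝓜(ℂ, G) w w‖ ≤ ‖w‖ * K := by
    rw [← DoubleCentralizer.norm_snd]
    refine ContinuousLinearMap.opNorm_le_bound _ (by positivity) fun g => ?_
    rw [← norm_coe, ← coe_mul_eq]
    have h2 : (g : 𝓜(ℂ, G)) * inner 𝓜(ℂ, G) w w = inner 𝓜(ℂ, G) w (smulVec g w) := by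
      simp only [WithCStarModule.pi_inner, smulVec, WithCStarModule.equiv_symm_pi_apply,
        WithCStarModule.inner_def, Finset.mul_sum, mul_assoc]
    rw [h2]
    calc _ ≤ ‖w‖ * ‖smulVec (g : 𝓜(ℂ, G)) w‖ := CStarModule.norm_inner_le _
      _ ≤ ‖w‖ * (K * ‖g‖) := by gcongr; exact h g
      _ = _ := by ring
  rw [← CStarModule.norm_sq_eq 𝓜(ℂ, G), sq] at h1
  rcases (norm_nonneg w).eq_or_lt with h0 | h0
  · rwa [← h0]
  · exact le_of_mul_le_mul_left h1 h0

/-- Lower semicontinuity of the matrix norm along `e T → T`, a limit that holds only strictly.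
Matrices act on row vectors, so the left action of `g` commutes with `T`, and it suffices to test on
vectors `g v`. -/
theorem cstarMatrixNorm_le_of_tendsto {n : ℕ} {ι : Type*} {l : Filter ι} [l.NeBot] {e : ι → G}
    (he : ∀ g, Tendsto (fun i => g * e i) l (𝓝 g)) (T : Matrix (Fin n) (Fin n) 𝓜(ℂ, G)) {c : ℝ}
    (hT : ∀ᶠ i in l, cstarMatrixNorm (T.map ((e i : 𝓜(ℂ, G)) * ·)) ≤ c) :
    cstarMatrixNorm T ≤ c := by
  have hc : 0 ≤ c := by
    obtain ⟨i, hi⟩ := hT.exists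
    exact (cstarMatrixNorm_nonneg _).trans hi
  refine ContinuousLinearMap.opNorm_le_bound _ hc fun v => ?_
  refine norm_vec_le _ (by positivity) fun g => ?_
  have h1 : smulVec (g : 𝓜(ℂ, G)) (CStarMatrix.toCLM (CStarMatrix.ofMatrix T) v) =
      CStarMatrix.toCLM (CStarMatrix.ofMatrix T) (smulVec g v) := by
    simp only [CStarMatrix.toCLM_apply_eq_sum, smulVec, WithCStarModule.equiv_symm_pi_apply,
      Finset.mul_sum, mul_assoc]
  have h2 : Tendsto (fun i => CStarMatrix.toCLM
      (CStarMatrix.ofMatrix (T.map ((e i : 𝓜(ℂ, G)) * ·))) (smulVec g v)) l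
      (𝓝 (CStarMatrix.toCLM (CStarMatrix.ofMatrix T) (smulVec g v))) := by
    rw [(WithCStarModule.equivL (A := 𝓜(ℂ, G)) ℂ).toHomeomorph.isInducing.tendsto_nhds_iff,
      tendsto_pi_nhds]
    intro k
    have h3 : ∀ S : CStarMatrix (Fin n) (Fin n) 𝓜(ℂ, G),
        (WithCStarModule.equivL (A := 𝓜(ℂ, G)) ℂ).toHomeomorph
          (CStarMatrix.toCLM S (smulVec g v)) k = ∑ i, g * v i * S i k := fun S => by
      simp only [CStarMatrix.toCLM_apply_eq_sum]
      rfl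
    simp only [Function.comp_def, h3]
    refine tendsto_finsetSum _ fun i _ => ?_
    -- Since `g v i` lies in `G`, the product `g v i e t` converges in norm, which turns strict
    -- convergence into norm convergence.
    have h4 : ∀ t, (g : 𝓜(ℂ, G)) * v i *
        CStarMatrix.ofMatrix (T.map ((e t : 𝓜(ℂ, G)) * ·)) i k =
        (((v i).snd g * e t : G) : 𝓜(ℂ, G)) * T i k := fun t => by
      rw [coe_mul, ← coe_mul_eq, mul_assoc _ (e t : 𝓜(ℂ, G))]
      rfl
    simp only [h4]
    rw [coe_mul_eq]
    exact ((continuous_coe.tendsto _).comp (he _)).mul_const _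
  rw [h1]
  refine le_of_tendsto h2.norm ?_
  filter_upwards [hT] with i hi
  calc _ ≤ cstarMatrixNorm (T.map ((e i : 𝓜(ℂ, G)) * ·)) * ‖smulVec (g : 𝓜(ℂ, G)) v‖ :=
        ContinuousLinearMap.le_opNorm _ _
    _ ≤ c * (‖(g : 𝓜(ℂ, G))‖ * ‖v‖) := by
        gcongr
        exact norm_smulVec_le _ _
    _ = _ := by rw [norm_coe]; ring

end DoubleCentralizer

/-- A bounded net of operators which converges pointwise on a dense set converges pointwise. -/
theorem exists_continuousLinearMap_tendsto {ι : Type*} {l : Filter ι} [l.NeBot] {E : Type*}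
    [NormedAddCommGroup E] [NormedSpace ℂ E] [CompleteSpace E] {T : ι → E →L[ℂ] E} {r : ℝ}
    (hT : ∀ᶠ i in l, ‖T i‖ ≤ r) {S : Set E} (hS : Dense S)
    (h : ∀ x ∈ S, ∃ y, Tendsto (fun i => T i x) l (𝓝 y)) :
    ∃ L : E →L[ℂ] E, ∀ x, Tendsto (fun i => T i x) l (𝓝 (L x)) := by
  have hr : 0 ≤ r := by
    obtain ⟨i, hi⟩ := hT.exists
    exact (norm_nonneg _).trans hi
  have hlim : ∀ x, ∃ y, Tendsto (fun i => T i x) l (𝓝 y) := by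
    intro x
    refine cauchy_map_iff_exists_tendsto.1 (Metric.cauchy_iff.2 ⟨inferInstance, fun ε hε => ?_⟩)
    -- Two errors of `ε/3` from replacing `x` by `x'` and two of `ε/6` from the limit at `x'` add up
    -- to `ε`; `r + 1` avoids division by zero.
    obtain ⟨x', hx', hd⟩ := Metric.dense_iff.1 hS x (ε / (3 * (r + 1))) (by positivity)
    obtain ⟨y, hy⟩ := h x' hd
    refine ⟨_, image_mem_map (hT.and (Metric.tendsto_nhds.1 hy (ε / 6) (by positivity))), ?_⟩
    have key : ∀ i, ‖T i‖ ≤ r → dist (T i x) (T i x') < ε / 3 := by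
      intro i hi
      rw [Metric.mem_ball, dist_comm, dist_eq_norm, lt_div_iff₀ (by positivity)] at hx'
      rw [dist_eq_norm, ← map_sub]
      have := (T i).le_of_opNorm_le hi (x - x')
      nlinarith [norm_nonneg (x - x')]
    rintro _ ⟨i, ⟨hi, hi'⟩, rfl⟩ _ ⟨k, ⟨hk, hk'⟩, rfl⟩
    have h1 := key i hi
    have h2 := key k hk
    have h3 := dist_triangle4 (T i x) (T i x') (T k x') (T k x)
    have h4 := dist_triangle_right (T i x') (T k x') y
    rw [dist_comm (T k x') (T k x)] at h3
    linarith
  choose L hL using hlim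
  refine ⟨LinearMap.mkContinuous
    { toFun := L
      map_add' := fun x y => tendsto_nhds_unique (hL (x + y))
        (by simpa only [map_add] using (hL x).add (hL y))
      map_smul' := fun c x => tendsto_nhds_unique (hL (c • x))
        (by simpa only [map_smul, RingHom.id_apply] using (hL x).const_smul c) } r fun x => ?_, hL⟩
  refine le_of_tendsto (hL x).norm ?_
  filter_upwards [hT] with i hi using (T i).le_of_opNorm_le hi x

/-! ### Extending representations of an ideal to multipliers -/

namespace ClosedIdeal

/-- Multiplication of an element of an ideal on the left by an element of the algebra. -/
def mulLeft {B : Type u} [NonUnitalNormedRing B] [NormedSpace ℂ B] (A : ClosedIdeal B) (b : B)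
    (a : A) : A :=
  ⟨b * a, A.mul_mem_left' b a.2⟩

variable {B : Type u} [OperatorAlgebra B] {A : ClosedIdeal B} {G : Type u}
  [NonUnitalCStarAlgebra G] {π : A →ₙₐ[ℂ] G} {l : Filter A}

theorem continuous_of_isCompletelyContractive (hπ : IsCompletelyContractive π) :
    Continuous π :=
  AddMonoidHomClass.continuous_of_bound π 1 fun a => by
    rw [one_mul]
    exact norm_map_le hπ a

/-- By nondegeneracy a multiplier is determined by its products with `π(A)`. All algebraic
identities for the extension are checked this way. -/
theorem multiplier_eq [l.NeBot] (hl : ∀ g, Tendsto (fun e => π e * g) l (𝓝 g))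
    {m m' : 𝓜(ℂ, G)} (h : ∀ a, m * (π a : 𝓜(ℂ, G)) = m' * (π a : 𝓜(ℂ, G))) : m = m' := by
  refine DoubleCentralizer.eq_of_fst_eq fun g => ?_
  refine tendsto_nhds_unique ((m.fst.continuous.tendsto _).comp (hl g)) ?_
  refine ((m'.fst.continuous.tendsto _).comp (hl g)).congr fun a => ?_
  exact (congrArg (fun t : 𝓜(ℂ, G) => t.fst g) (h a)).symm

/-- The left and right parts are the pointwise limits of multiplication by the bounded net `π(be)`.
On the dense sets `π(A)G` and `Gπ(A)` the limits exist because `bea → ba` and `(ab)e → ab` in `A`.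
-/
theorem exists_multiplier (hu : l.IsApproximateUnit) (hu1 : ∀ᶠ e in l, ‖e‖ ≤ 1)
    (hπ : IsCompletelyContractive π) (hl : ∀ g, Tendsto (fun e => π e * g) l (𝓝 g))
    (hr : ∀ g, Tendsto (fun e => g * π e) l (𝓝 g)) (b : B) :
    ∃ m : 𝓜(ℂ, G), ∀ a, m * (π a : 𝓜(ℂ, G)) = (π (A.mulLeft b a) : 𝓜(ℂ, G)) := by
  have _ := hu.neBot
  have hb : ∀ᶠ e in l, ‖π (A.mulLeft b e)‖ ≤ ‖b‖ := by
    filter_upwards [hu1] with e he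
    refine (norm_map_le hπ _).trans ?_
    exact (norm_mul_le b (e : B)).trans (mul_le_of_le_one_right (norm_nonneg _) he)
  have hL : ∀ (a : A) (g : G),
      Tendsto (fun e => π (A.mulLeft b e) * (π a * g)) l (𝓝 (π (A.mulLeft b a) * g)) := by
    intro a g
    have h1 : Tendsto (fun e : A => A.mulLeft b (e * a)) l (𝓝 (A.mulLeft b a)) := by
      refine tendsto_subtype_rng.2 ?_
      exact ((continuous_subtype_val.tendsto _).comp (hu.tendsto_mul_right a)).const_mul b
    refine ((((continuous_of_isCompletelyContractive hπ).tendsto _).comp h1).mul_const g).congr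
      fun e => ?_
    rw [← mul_assoc, ← map_mul]
    exact congrArg (fun t => π t * g) (Subtype.ext (mul_assoc b (e : B) a).symm)
  have hR : ∀ (a : A) (g : G), ∃ h, Tendsto (fun e => g * π a * π (A.mulLeft b e)) l (𝓝 h) := by
    intro a g
    have h1 := hu.tendsto_mul_left (⟨a * b, A.mul_mem_right' b a.2⟩ : A)
    refine ⟨_, ((((continuous_of_isCompletelyContractive hπ).tendsto _).comp h1).const_mul
      g).congr fun e => ?_⟩
    rw [mul_assoc, ← map_mul]
    exact congrArg (fun t => g * π t) (Subtype.ext (mul_assoc (a : B) b e))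
  obtain ⟨L, hL'⟩ := exists_continuousLinearMap_tendsto (l := l) (r := ‖b‖)
    (T := fun e => ContinuousLinearMap.mul ℂ G (π (A.mulLeft b e)))
    (S := {x | ∃ a g, x = π a * g})
    (by filter_upwards [hb] with e he using (ContinuousLinearMap.opNorm_mul_apply_le _ _ _).trans he)
    (fun x => mem_closure_of_tendsto (hl x) (Eventually.of_forall fun e => ⟨e, x, rfl⟩))
    (by rintro _ ⟨a, g, rfl⟩; exact ⟨_, hL a g⟩)
  obtain ⟨R, hR'⟩ := exists_continuousLinearMap_tendsto (l := l) (r := ‖b‖)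
    (T := fun e => (ContinuousLinearMap.mul ℂ G).flip (π (A.mulLeft b e)))
    (S := {x | ∃ a g, x = g * π a})
    (by
      filter_upwards [hb] with e he
      refine ContinuousLinearMap.opNorm_le_bound _ (norm_nonneg b) fun x => ?_
      refine (norm_mul_le x _).trans ?_
      rw [mul_comm]
      gcongr)
    (fun x => mem_closure_of_tendsto (hr x) (Eventually.of_forall fun e => ⟨e, x, rfl⟩))
    (by rintro _ ⟨a, g, rfl⟩; exact hR a g)
  refine ⟨⟨(L, R), fun x y => ?_⟩, fun a => DoubleCentralizer.eq_of_fst_eq fun g => ?_⟩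
  -- Centrality is the limit of `(x π(be)) y = x (π(be) y)`.
  · refine tendsto_nhds_unique ((hR' x).mul_const y) (((hL' y).const_mul x).congr fun e => ?_)
    exact (mul_assoc x _ y).symm
  · exact tendsto_nhds_unique (hL' (π a * g)) (hL a g)

/-- A nondegenerate completely contractive homomorphism on an approximately unital ideal `A` of `B`
extends to a completely contractive homomorphism from `B` into the multiplier algebra. -/
theorem exists_extension_multiplier (hu : l.IsApproximateUnit) (hu1 : ∀ᶠ e in l, ‖e‖ ≤ 1)
    (hπ : IsCompletelyContractive π) (hl : ∀ g, Tendsto (fun e => π e * g) l (𝓝 g))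
    (hr : ∀ g, Tendsto (fun e => g * π e) l (𝓝 g)) :
    ∃ σ : B →ₙₐ[ℂ] 𝓜(ℂ, G), IsCompletelyContractive σ ∧ ∀ a : A, σ a = (π a : 𝓜(ℂ, G)) := by
  have _ := hu.neBot
  choose σ hσ using exists_multiplier hu hu1 hπ hl hr
  have hA : ∀ a : A, σ a = (π a : 𝓜(ℂ, G)) := fun a => multiplier_eq hl fun a' => by
    rw [hσ, ← DoubleCentralizer.coe_mul, ← map_mul]
    rfl
  have hmul : ∀ x y, σ (x * y) = σ x * σ y := fun x y => multiplier_eq hl fun a => by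
    rw [mul_assoc, hσ, hσ, hσ]
    exact congrArg (fun t => (π t : 𝓜(ℂ, G))) (Subtype.ext (mul_assoc x y (a : B)))
  have hadd : ∀ x y, σ (x + y) = σ x + σ y := fun x y => multiplier_eq hl fun a => by
    rw [add_mul, hσ, hσ, hσ]
    refine Eq.trans ?_ (map_add ((DoubleCentralizer.coeHom (𝕜 := ℂ)).toNonUnitalAlgHom.comp π)
      (A.mulLeft x a) (A.mulLeft y a))
    exact congrArg (fun t => (π t : 𝓜(ℂ, G))) (Subtype.ext (add_mul x y (a : B)))
  have hsmul : ∀ (c : ℂ) x, σ (c • x) = c • σ x := fun c x => multiplier_eq hl fun a => by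
    rw [smul_mul_assoc, hσ, hσ]
    refine Eq.trans ?_ (map_smul ((DoubleCentralizer.coeHom (𝕜 := ℂ)).toNonUnitalAlgHom.comp π)
      c (A.mulLeft x a))
    exact congrArg (fun t => (π t : 𝓜(ℂ, G))) 
      (Subtype.ext (OperatorAlgebra.smul_mul c x (a : B)))
  let τ : B →ₙₐ[ℂ] 𝓜(ℂ, G) :=
    { toFun := σ
      map_smul' := hsmul
      map_zero' := by simpa using hsmul 0 0
      map_add' := hadd
      map_mul' := hmul }
  refine ⟨τ, fun n M => ?_, hA⟩
  refine DoubleCentralizer.cstarMatrixNorm_le_of_tendsto hr _ ?_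
  filter_upwards [hu1] with e he
  -- Multiplying by `e` on the left brings the entries of `M` into `A`, where the complete
  -- contractivity of `π` is available.
  let M' : Matrix (Fin n) (Fin n) A := M.map fun b => ⟨(e : B) * b, A.mul_mem_right' b e.2⟩
  have h1 : (M.map τ).map ((π e : 𝓜(ℂ, G)) * ·) =
      (M'.map π).map (DoubleCentralizer.coeHom (𝕜 := ℂ)) := by
    ext1 i k
    change (π e : 𝓜(ℂ, G)) * σ (M i k) = (π (M' i k) : 𝓜(ℂ, G))
    rw [← hA, ← hA, ← hmul]
    rfl
  rw [h1]
  calc _ ≤ cstarMatrixNorm (M'.map π) := cstarMatrixNorm_map_le _ _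
    _ ≤ MatrixNorm.mnorm M' := hπ n M'
    _ = MatrixNorm.mnorm (M.map ((e : B) * ·)) := rfl
    _ ≤ ‖(e : B)‖ * MatrixNorm.mnorm M := OperatorAlgebra.mnorm_const_mul_le _ _
    _ ≤ MatrixNorm.mnorm M :=
      mul_le_of_le_one_left (OperatorAlgebra.mnorm_nonneg M) he

end ClosedIdeal

/-! ### Generated C⋆-subalgebras and quotients -/

section Generated

universe w

variable {C : Type u} [NonUnitalCStarAlgebra C] {E : Type v} [NonUnitalCStarAlgebra E]
  {F : Type w} [NonUnitalCStarAlgebra F]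

theorem cstarGenerated_le {S : Set C} {K : NonUnitalStarSubalgebra ℂ C}
    (hK : IsClosed (K : Set C)) (h : S ⊆ K) : cstarGenerated S ≤ K :=
  closure_minimal (NonUnitalStarAlgebra.adjoin_le h) hK

theorem mem_of_mem_cstarGenerated (φ : C →⋆ₙₐ[ℂ] E) {S : Set C}
    {K : NonUnitalStarSubalgebra ℂ E} (hK : IsClosed (K : Set E)) (h : ∀ s ∈ S, φ s ∈ K) {c : C}
    (hc : c ∈ cstarGenerated S) : φ c ∈ K :=
  cstarGenerated_le (K := K.comap φ)
    (hK.preimage (AddMonoidHomClass.continuous_of_bound φ 1 fun x => by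
      rw [one_mul]
      exact NonUnitalStarAlgHom.norm_apply_le φ x)) h hc

theorem exists_factor_of_injective (φ : C →⋆ₙₐ[ℂ] E) (i : F →⋆ₙₐ[ℂ] E)
    (hi : Function.Injective i) (h : ∀ c, ∃ f, i f = φ c) :
    ∃ ψ : C →⋆ₙₐ[ℂ] F, ∀ c, i (ψ c) = φ c := by
  choose ψ hψ using h
  exact ⟨{ toFun := ψ
           map_smul' := fun r x => hi (by simp [hψ])
           map_zero' := hi (by simp [hψ])
           map_add' := fun x y => hi (by simp [hψ])
           map_mul' := fun x y => hi (by simp [hψ])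
           map_star' := fun x => hi (by simp [hψ, map_star]) }, hψ⟩

end Generated

namespace ClosedStarIdeal

variable {C : Type u} [NonUnitalCStarAlgebra C] {E : Type v} [NonUnitalCStarAlgebra E]
  (I : ClosedStarIdeal C)

/-- The quotient map as a `*`-homomorphism. -/
noncomputable def projStar : C →⋆ₙₐ[ℂ] I.Quot :=
  { I.proj with map_star' := fun _ => rfl }

theorem projStar_surjective : Function.Surjective I.projStar := I.mkₗ_surjective

theorem projStar_eq_zero_iff {c : C} : I.projStar c = 0 ↔ c ∈ I :=
  Submodule.Quotient.mk_eq_zero I.toSubmodule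

/-- A `*`-homomorphism which vanishes on a closed ideal factors through the quotient. -/
noncomputable def lift (φ : C →⋆ₙₐ[ℂ] E) (h : ∀ d ∈ I, φ d = 0) : I.Quot →⋆ₙₐ[ℂ] E :=
  let L : I.Quot →ₗ[ℂ] E := I.toSubmodule.liftQ (φ : C →ₗ[ℂ] E) h
  { toFun := L
    map_smul' := L.map_smul
    map_zero' := L.map_zero
    map_add' := L.map_add
    map_mul' := fun x y => by
      obtain ⟨x, rfl⟩ := I.mkₗ_surjective x
      obtain ⟨y, rfl⟩ := I.mkₗ_surjective y
      exact map_mul φ x y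
    map_star' := fun x => by
      obtain ⟨x, rfl⟩ := I.mkₗ_surjective x
      exact map_star φ x }

theorem lift_mkₗ (φ : C →⋆ₙₐ[ℂ] E) (h : ∀ d ∈ I, φ d = 0) (c : C) :
    I.lift φ h (I.mkₗ c) = φ c := rfl

/-- When the ideal is exactly the kernel, the induced map on the quotient is an injective
`*`-homomorphism, hence isometric. -/
theorem norm_mkₗ_eq (φ : C →⋆ₙₐ[ℂ] E) (h : ∀ d, φ d = 0 ↔ d ∈ I) (c : C) :
    ‖I.mkₗ c‖ = ‖φ c‖ := by
  rw [← I.lift_mkₗ φ (fun d hd => (h d).2 hd)]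
  refine (NonUnitalStarAlgHom.norm_map _ ((injective_iff_map_eq_zero _).2 fun x hx => ?_) _).symm
  obtain ⟨x, rfl⟩ := I.mkₗ_surjective x
  exact (Submodule.Quotient.mk_eq_zero I.toSubmodule).2 ((h x).1 hx)

/-- The ideal of matrices with entries in a given closed ideal. -/
def matrix (n : ℕ) : ClosedStarIdeal (CStarMatrix (Fin n) (Fin n) C) where
  carrier := {M | ∀ i k, M i k ∈ I}
  add_mem' h h' i k := add_mem (h i k) (h' i k)
  zero_mem' _ _ := zero_mem I
  smul_mem' c _ h i k := I.smul_mem' c (h i k)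
  mul_mem_left' M N h i k := by
    rw [CStarMatrix.mul_apply]
    exact sum_mem fun x _ => I.mul_mem_left' _ (h x k)
  mul_mem_right' M N h i k := by
    rw [CStarMatrix.mul_apply]
    exact sum_mem fun x _ => I.mul_mem_right' _ (h i x)
  isClosed' := by
    simp only [Set.ofPred_forall]
    exact isClosed_iInter fun i => isClosed_iInter fun k =>
      IsClosed.preimage (f := fun M : Fin n → Fin n → C => M i k) (by fun_prop) I.isClosed'
  star_mem' h i k := I.star_mem' (h k i)

/-- This identifies `M_n(C)/M_n(I)` isometrically with a subalgebra of `M_n(C/I)`, so matrix norms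
over `C/I` become distances to an ideal. -/
theorem norm_mkₗ_matrix {n : ℕ} (M : Matrix (Fin n) (Fin n) C) :
    ‖(I.matrix n).mkₗ (CStarMatrix.ofMatrix M)‖ = cstarMatrixNorm (M.map I.projStar) := by
  refine (I.matrix n).norm_mkₗ_eq (CStarMatrix.mapₙₐ (n := Fin n) I.projStar) (fun d => ?_) _
  rw [← CStarMatrix.ext_iff]
  exact forall₂_congr fun i k => I.projStar_eq_zero_iff

end ClosedStarIdeal

/-! ### The maximal C⋆-cover of an approximately unital ideal -/

/-- A homomorphism, with codomain restricted to the C⋆-algebra generated by its range. -/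
def NonUnitalAlgHom.toCStarGenerated {A : Type u} [NonUnitalRing A] [Module ℂ A] {F : Type v}
    [NonUnitalCStarAlgebra F] (π : A →ₙₐ[ℂ] F) : A →ₙₐ[ℂ] cstarGenerated (Set.range π) where
  toFun a := ⟨π a, subset_cstarGenerated _ (Set.mem_range_self a)⟩
  map_smul' c a := Subtype.ext (map_smul π c a)
  map_zero' := Subtype.ext (map_zero π)
  map_add' a b := Subtype.ext (map_add π a b)
  map_mul' a b := Subtype.ext (map_mul π a b)

theorem cstarMatrixNorm_map_subtype {C : Type u} [NonUnitalCStarAlgebra C] {S : Set C} {n : ℕ}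
    (M : Matrix (Fin n) (Fin n) (cstarGenerated S)) :
    cstarMatrixNorm (M.map fun x => (x : C)) = cstarMatrixNorm M :=
  cstarMatrixNorm_map_of_injective (NonUnitalStarSubalgebraClass.subtype (cstarGenerated S))
    Subtype.val_injective M

namespace ClosedIdeal

variable {B : Type u} [OperatorAlgebra B] {A : ClosedIdeal B} {l : Filter A}

/-- A completely contractive homomorphism on an approximately unital ideal factors through a
`*`-homomorphism on any algebra generated by a completely isometric image of the ideal, as soon as
homomorphisms on the whole algebra do. -/
theorem exists_extension_restrict {C : Type v} [NonUnitalCStarAlgebra C] {j : B →ₙₐ[ℂ] C}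
    (hj : ∀ (F : Type u) [NonUnitalCStarAlgebra F] (π : B →ₙₐ[ℂ] F),
      IsCompletelyContractive π → ∃ φ : C →⋆ₙₐ[ℂ] F, ∀ b : B, φ (j b) = π b)
    (hu : l.IsApproximateUnit) (hu1 : ∀ᶠ e in l, ‖e‖ ≤ 1) {F : Type u}
    [NonUnitalCStarAlgebra F] {π : A →ₙₐ[ℂ] F} (hπ : IsCompletelyContractive π) :
    ∃ φ : cstarGenerated (j '' A) →⋆ₙₐ[ℂ] F, ∀ a, φ (A.restrict j a) = π a := by
  have hcont := continuous_of_isCompletelyContractive hπ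
  have hu1' : ∀ᶠ e in l, ‖π e‖ ≤ 1 := by
    filter_upwards [hu1] with e he using (norm_map_le hπ e).trans he
  have happrox (g : cstarGenerated (Set.range π)) :=
    tendsto_of_mem_cstarGenerated (S := Set.range π) hu1'
      (by
        rintro _ ⟨a, rfl⟩
        simpa only [Function.comp_def, map_mul] using
          (hcont.tendsto _).comp (hu.tendsto_mul_right a))
      (by
        rintro _ ⟨a, rfl⟩
        simpa only [Function.comp_def, map_mul] using
          (hcont.tendsto _).comp (hu.tendsto_mul_left a)) g.2
  obtain ⟨σ, hσ, hσA⟩ := exists_extension_multiplier (π := π.toCStarGenerated) hu hu1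
    (fun n M => (cstarMatrixNorm_map_subtype _).symm.trans_le (hπ n M))
    (fun g => tendsto_subtype_rng.2 (happrox g).1) (fun g => tendsto_subtype_rng.2 (happrox g).2)
  obtain ⟨φ, hφ⟩ := hj _ σ hσ
  let i := DoubleCentralizer.coeHom (𝕜 := ℂ) (A := cstarGenerated (Set.range π))
  have hi : Function.Injective i := DoubleCentralizer.coe_injective
  -- The copy of the generated algebra in its multiplier algebra is closed, so it contains the image
  -- of everything generated by `j(A)`.
  have hclosed : IsClosed (NonUnitalStarAlgHom.range i : Set 𝓜(ℂ, cstarGenerated (Set.range π))) :=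
    (NonUnitalStarAlgHom.isometry i hi).isClosedEmbedding.isClosed_range
  obtain ⟨ψ, hψ⟩ := exists_factor_of_injective
    (φ.comp (NonUnitalStarSubalgebraClass.subtype (cstarGenerated (j '' A)))) i hi
    (fun c => mem_of_mem_cstarGenerated φ hclosed
      (by
        rintro _ ⟨a, ha, rfl⟩
        exact ⟨_, ((hφ a).trans (hσA ⟨a, ha⟩)).symm⟩) c.2)
  refine ⟨(NonUnitalStarSubalgebraClass.subtype _).comp ψ, fun a => ?_⟩
  refine congrArg Subtype.val (a₂ := π.toCStarGenerated a) (hi ?_)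
  exact (hψ _).trans ((hφ a).trans (hσA a))

variable {C : Type v} [NonUnitalCStarAlgebra C] {j : B →ₙₐ[ℂ] C}

theorem isCStarCover_restrict (hj : IsCompletelyIsometric j) : IsCStarCover (A.restrict j) where
  completelyIsometric n M := by
    rw [← cstarMatrixNorm_map_subtype]
    exact hj n (M.map fun a => (a : B))
  generates := by
    rw [eq_top_iff]
    rintro ⟨d, hd⟩ -
    let i := NonUnitalStarSubalgebraClass.subtype (cstarGenerated (j '' A))
    have hclosed : IsClosed
        ((cstarGenerated (Set.range (A.restrict j))).map i : Set C) :=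
      (cstarGenerated.isClosed (j '' A)).isClosedEmbedding_subtypeVal.isClosedMap _
        (cstarGenerated.isClosed (Set.range (A.restrict j)))
    obtain ⟨d', hd', h⟩ := cstarGenerated_le hclosed
      (by
        rintro _ ⟨a, ha, rfl⟩
        exact ⟨A.restrict j ⟨a, ha⟩, subset_cstarGenerated _ (Set.mem_range_self _), rfl⟩) hd
    rwa [← show d' = ⟨d, hd⟩ from Subtype.ext h]

/-! ### The quotient by an approximately unital ideal -/

theorem tendsto_restrict (hj : IsCompletelyIsometric j) (hu : l.IsApproximateUnit)
    (hu1 : ∀ᶠ e in l, ‖e‖ ≤ 1) {d : C} (hd : d ∈ cstarGenerated (j '' A)) :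
    Tendsto (fun e : A => j e * d) l (𝓝 d) ∧ Tendsto (fun e : A => d * j e) l (𝓝 d) := by
  have hcont : Continuous j := AddMonoidHomClass.continuous_of_bound j 1 fun b => by
    rw [one_mul, hj.norm_map]
  have hcont' : Continuous fun a : A => j a := hcont.comp continuous_subtype_val
  refine tendsto_of_mem_cstarGenerated 
    (hu1.mono fun e he => (hj.norm_map (e : B)).trans_le he) ?_ ?_ hd
  · rintro _ ⟨a, ha, rfl⟩
    refine ((hcont'.tendsto _).comp (hu.tendsto_mul_right ⟨a, ha⟩)).congr fun e => ?_
    exact map_mul j (e : B) a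
  · rintro _ ⟨a, ha, rfl⟩
    refine ((hcont'.tendsto _).comp (hu.tendsto_mul_left ⟨a, ha⟩)).congr fun e => ?_
    exact map_mul j a (e : B)

/-- For `c = j(b)` the product `j(b) d` is the limit of `j(be) d`, with `be ∈ A`. Both sides are
treated together because the adjoint step exchanges them. -/
theorem mul_mem_cstarGenerated (hj : IsCStarCover j) (hu : l.IsApproximateUnit)
    (hu1 : ∀ᶠ e in l, ‖e‖ ≤ 1) (c : C) :
    ∀ d ∈ cstarGenerated (j '' A), c * d ∈ cstarGenerated (j '' A) ∧
      d * c ∈ cstarGenerated (j '' A) := by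
  have _ := hu.neBot
  have hD := cstarGenerated.isClosed (j '' A)
  have hmem : ∀ a ∈ A, j a ∈ cstarGenerated (j '' A) := fun a ha =>
    subset_cstarGenerated _ (Set.mem_image_of_mem j ha)
  have hc : c ∈ closure (NonUnitalStarAlgebra.adjoin ℂ (Set.range j) : Set C) := by
    change c ∈ cstarGenerated (Set.range j)
    rw [hj.generates]
    trivial
  intro d hd
  revert hd d
  have hclosed : IsClosed {c : C | ∀ d ∈ cstarGenerated (j '' A),
      c * d ∈ cstarGenerated (j '' A) ∧ d * c ∈ cstarGenerated (j '' A)} := by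
    simp only [Set.ofPred_forall]
    refine isClosed_iInter fun d => isClosed_iInter fun _ => ?_
    exact (hD.preimage (f := fun c => c * d) (by fun_prop)).inter
      (hD.preimage (f := fun c => d * c) (by fun_prop))
  refine closure_minimal ?_ hclosed hc
  intro c hc
  induction hc using NonUnitalStarAlgebra.adjoin_induction with
  | mem x hx =>
    obtain ⟨b, rfl⟩ := hx
    intro d hd
    obtain ⟨h1, h2⟩ := tendsto_restrict hj.completelyIsometric hu hu1 hd
    refine ⟨hD.mem_of_tendsto (h1.const_mul (j b)) (Eventually.of_forall fun e => ?_),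
      hD.mem_of_tendsto (h2.mul_const (j b)) (Eventually.of_forall fun e => ?_)⟩
    · rw [← mul_assoc, ← map_mul]
      exact mul_mem (hmem _ (A.mul_mem_left' b e.2)) hd
    · rw [mul_assoc, ← map_mul]
      exact mul_mem hd (hmem _ (A.mul_mem_right' b e.2))
  | add x y _ _ hx hy =>
    intro d hd
    rw [add_mul, mul_add]
    exact ⟨add_mem (hx d hd).1 (hy d hd).1, add_mem (hx d hd).2 (hy d hd).2⟩
  | zero =>
    intro d _
    rw [zero_mul, mul_zero]
    exact ⟨zero_mem _, zero_mem _⟩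
  | mul x y _ _ hx hy =>
    intro d hd
    rw [mul_assoc, ← mul_assoc d]
    exact ⟨(hx _ (hy d hd).1).1, (hy _ (hx d hd).2).2⟩
  | smul r x _ hx =>
    intro d hd
    rw [smul_mul_assoc, mul_smul_comm]
    exact ⟨SMulMemClass.smul_mem r (hx d hd).1, SMulMemClass.smul_mem r (hx d hd).2⟩
  | star x _ hx =>
    intro d hd
    have h := hx _ (star_mem hd)
    have h1 := star_mem h.2
    have h2 := star_mem h.1
    rw [star_mul, star_star] at h1 h2
    exact ⟨h1, h2⟩

/-- The C⋆-algebra generated by an approximately unital ideal of `B`, as an ideal of a C⋆-cover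
of `B`. -/
def generatedIdeal (hj : IsCStarCover j) (hu : l.IsApproximateUnit)
    (hu1 : ∀ᶠ e in l, ‖e‖ ≤ 1) : ClosedStarIdeal C where
  carrier := cstarGenerated (j '' A)
  add_mem' := add_mem
  zero_mem' := zero_mem (cstarGenerated (j '' A))
  smul_mem' r _ h := SMulMemClass.smul_mem r h
  mul_mem_left' c d h := (mul_mem_cstarGenerated hj hu hu1 c d h).1
  mul_mem_right' c d h := (mul_mem_cstarGenerated hj hu hu1 c d h).2
  isClosed' := cstarGenerated.isClosed (j '' A)
  star_mem' := star_mem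

theorem bddBelow_mnorm {n : ℕ} (X : Matrix (Fin n) (Fin n) A.Quot) :
    BddBelow {r : ℝ | ∃ M, M.map A.proj = X ∧ MatrixNorm.mnorm M = r} := by
  refine ⟨0, ?_⟩
  rintro _ ⟨M, -, rfl⟩
  exact OperatorAlgebra.mnorm_nonneg M

theorem mnorm_map_proj_le {n : ℕ} (M : Matrix (Fin n) (Fin n) B) :
    MatrixNorm.mnorm (M.map A.proj) ≤ MatrixNorm.mnorm M :=
  csInf_le (bddBelow_mnorm _) ⟨M, rfl, rfl⟩

theorem exists_map_proj_eq {n : ℕ} (X : Matrix (Fin n) (Fin n) A.Quot) :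
    ∃ M : Matrix (Fin n) (Fin n) B, M.map A.proj = X := by
  choose M hM using fun i k => A.mkₗ_surjective (X i k)
  exact ⟨Matrix.of M, Matrix.ext hM⟩

/-- One inequality holds because `*`-homomorphisms contract matrix norms. The other applies the
averaging argument in `M_n(C)` to the ideal `M_n(D)`. -/
theorem isCompletelyIsometric_quotMap (hj : IsCompletelyIsometric j) (hu : l.IsApproximateUnit)
    (hu1 : ∀ᶠ e in l, ‖e‖ ≤ 1) (D : ClosedStarIdeal C)
    (hD : (D : Set C) = cstarGenerated (j '' A)) (h : ∀ a ∈ A, j a ∈ D) :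
    IsCompletelyIsometric (quotMap A D.toClosedIdeal j h) := by
  have _ := hu.neBot
  have hmap : ∀ {n : ℕ} (M : Matrix (Fin n) (Fin n) B),
      (M.map A.proj).map (quotMap A D.toClosedIdeal j h) = (M.map j).map D.projStar :=
    fun M => rfl
  intro n X
  apply le_antisymm
  · obtain ⟨M, hM⟩ := exists_map_proj_eq X
    refine le_csInf ⟨_, M, hM, rfl⟩ ?_
    rintro _ ⟨M, rfl, rfl⟩
    rw [hmap, ← hj n M]
    exact cstarMatrixNorm_map_le _ _
  · obtain ⟨M, rfl⟩ := exists_map_proj_eq X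
    refine le_of_forall_gt_imp_ge_of_dense fun r hr => ?_
    rw [hmap, ← D.norm_mkₗ_matrix] at hr
    -- Averages of the diagonal matrices `j(e)` stay in the range of this map, so the witness is the
    -- diagonal matrix of `j(a)` for a single `a ∈ A`.
    let S : A.toSubmodule →ₗ[ℂ] CStarMatrix (Fin n) (Fin n) C :=
      ((CStarMatrix.scalarHom n C : C →ₗ[ℂ] _).comp (j : B →ₗ[ℂ] C)).comp A.toSubmodule.subtype
    obtain ⟨_, ⟨a, rfl⟩, ha⟩ := ClosedStarIdeal.exists_norm_sub_mul_lt (I := D.matrix n) (l := l)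
      (e := fun e : A => CStarMatrix.scalarHom n C (j e)) (S := LinearMap.range S)
      (by
        filter_upwards [hu1] with e he
        refine ⟨fun i k => ?_, (NonUnitalStarAlgHom.norm_apply_le _ _).trans
          ((hj.norm_map _).trans_le he)⟩
        change Matrix.diagonal (fun _ => j e) i k ∈ D
        rw [Matrix.diagonal_apply]
        split_ifs
        · exact h e e.2
        · exact zero_mem D)
      (by
        intro d hd
        refine tendsto_pi_nhds.2 fun i => tendsto_pi_nhds.2 fun k => ?_
        have hik : d i k ∈ cstarGenerated (j '' A) := hD.subset (hd i k)
        refine (tendsto_restrict hj hu hu1 hik).2.congr fun e => ?_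
        exact (CStarMatrix.mul_scalarHom_apply _ d i k).symm)
      (Eventually.of_forall fun e => ⟨e, rfl⟩) hr
    have h1 : CStarMatrix.ofMatrix (M.map j) - CStarMatrix.ofMatrix (M.map j) * S a =
        CStarMatrix.ofMatrix ((M.map fun b => b - b * (a : B)).map j) := by
      ext i k
      rw [CStarMatrix.sub_apply]
      refine (congrArg (j (M i k) - ·) (CStarMatrix.mul_scalarHom_apply _ _ i k)).trans ?_
      exact (congrArg (j (M i k) - ·) (map_mul j _ _).symm).trans (map_sub j _ _).symm
    rw [h1, ← cstarMatrixNorm_eq, hj] at ha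
    -- Each `b - ba` is another lift of the class of `b`, so the quotient norm is at most the norm
    -- just bounded.
    have h2 : M.map A.proj = (M.map fun b => b - b * (a : B)).map A.proj := by
      ext i k
      refine A.mkₗ_eq_iff.2 ?_
      change M i k - (M i k - M i k * (a : B)) ∈ A
      rw [sub_sub_cancel]
      exact A.mul_mem_left' _ a.2
    rw [h2]
    exact (mnorm_map_proj_le _).trans ha.le

theorem isMaxCStarCover_quotMap (hj : IsMaxCStarCover j) (hu : l.IsApproximateUnit)
    (hu1 : ∀ᶠ e in l, ‖e‖ ≤ 1) (D : ClosedStarIdeal C)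
    (hD : (D : Set C) = cstarGenerated (j '' A)) (h : ∀ a ∈ A, j a ∈ D) :
    IsMaxCStarCover (quotMap A D.toClosedIdeal j h) where
  completelyIsometric := isCompletelyIsometric_quotMap hj.completelyIsometric hu hu1 D hD h
  generates := by
    rw [eq_top_iff]
    intro x _
    obtain ⟨c, rfl⟩ := D.projStar_surjective x
    refine mem_of_mem_cstarGenerated D.projStar (S := Set.range j) (cstarGenerated.isClosed _) ?_
      (by rw [hj.generates]; trivial)
    rintro _ ⟨b, rfl⟩
    exact subset_cstarGenerated _ ⟨A.proj b, rfl⟩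
  exists_extension F _ π hπ := by
    obtain ⟨φ, hφ⟩ := hj.exists_extension F (π.comp A.proj)
      fun n M => (hπ n (M.map A.proj)).trans (mnorm_map_proj_le M)
    refine ⟨D.lift φ fun d hd => ?_, fun x => ?_⟩
    · have h1 : d ∈ cstarGenerated (j '' A) := hD.subset hd
      -- Vanishing on `j(A)` spreads to the generated algebra because the zero subalgebra is closed.
      refine NonUnitalStarAlgebra.mem_bot.1
        (mem_of_mem_cstarGenerated φ (K := ⊥) (by simp) ?_ h1)
      rintro _ ⟨a, ha, rfl⟩
      rw [hφ, NonUnitalStarAlgebra.mem_bot]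
      have h2 : A.proj a = 0 := (Submodule.Quotient.mk_eq_zero A.toSubmodule).2 ha
      exact (congrArg π h2).trans (map_zero π)
    · obtain ⟨b, rfl⟩ := A.mkₗ_surjective x
      exact hφ b

end ClosedIdeal

theorem lemma2p7 {B : Type u} [OperatorAlgebra B] (A : ClosedIdeal B)
    (hA : A.IsApproximatelyUnital) {C : Type v} [NonUnitalCStarAlgebra C] (j : B →ₙₐ[ℂ] C)
    (hj : IsMaxCStarCover j) :
    IsMaxCStarCover (A.restrict j) ∧
      ∃ (D : ClosedStarIdeal C) (hD : (D : Set C) = cstarGenerated (j '' A)),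
        IsMaxCStarCover (ClosedIdeal.quotMap A D.toClosedIdeal j fun a ha =>
          hD.symm.subset (subset_cstarGenerated _ (Set.mem_image_of_mem j ha))) := by
  obtain ⟨l, hu, hu1⟩ := hA
  exact ⟨{ ClosedIdeal.isCStarCover_restrict hj.completelyIsometric with
      exists_extension := fun F _ π hπ =>
        ClosedIdeal.exists_extension_restrict hj.exists_extension hu hu1 hπ },
    ClosedIdeal.generatedIdeal hj.toIsCStarCover hu hu1, rfl,
    ClosedIdeal.isMaxCStarCover_quotMap hj hu hu1 _ rfl _⟩
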